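/- Let $M$ be a finite-dimensional smooth Riemannian manifold without boundary, with metric $\langle\cdot,\cdot\rangle$, norm $\|\cdot\|$ and Levi-Civita connection $\nabla$. Let $\mathcal M=\mathrm{Imm}([0,1],M)$ be the space of smooth curves $c:[0,1]\to M$ with $c'(t)\neq 0$ for all $t\in[0,1]$. The tangent space $T_c\mathcal M$ is the space of smooth vector fields along $c$, and for $h\in T_c\mathcal M$, seen as a smooth curve in $TM$, the tangent space $T_hT\mathcal M$ is the space of smooth vector fields $\xi$ along $h$, $\xi(t)\in T_{h(t)}TM$. For $c\in\mathcal M$ and $h,k\in T_c\mathcal M$ put $$G_c(h,k)=\langle h(0),k(0)\rangle+\int_0^1\Big(\langle\nabla_\ell h^N,\nabla_\ell k^N\rangle+\tfrac14\langle\nabla_\ell h^T,\nabla_\ell k^T\rangle\Big)\,\|c'(t)\|\,dt,$$ where $\nabla_\ell h=\frac1{\|c'\|}\nabla_{c'}h$, $v=c'/\|c'\|$, $\nabla_\ell h^T=\langle\nabla_\ell h,v\rangle v$ and $\nabla_\ell h^N=\nabla_\ell h-\nabla_\ell h^T$. For $\xi\in T_{(p,u)}TM$, the velocity at time $0$ of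 a curve $s\mapsto(x(s),U(s))$ in $TM$ with $(x(0),U(0))=(p,u)$, let $\xi_H=x'(0)\in T_pM$ and $\xi_V=(\nabla_{x'}U)(0)\in T_pM$ be its horizontal and vertical projections. For $h\in T\mathcal M$ and $\xi,\eta\in T_hT\mathcal M$ put $$\tilde G_h(\xi,\eta)=\langle\xi(0)_H,\eta(0)_H\rangle+\int_0^1\langle\xi(t)_V,\eta(t)_V\rangle\,dt.$$ Let $R:\mathcal M\to T\mathcal M$, $R(c)=c'/\sqrt{\|c'\|}\in T_c\mathcal M$, be the square root velocity function. Its differential at $c$ sends $h\in T_c\mathcal M$ to $T_cR(h)\in T_{R(c)}T\mathcal M$, $T_cR(h)(t)=\partial_s|_{s=0}R(\gamma(s,\cdot))(t)$, where $\gamma(s,\cdot)\in\mathcal M$, $|s|<\varepsilon$, is any path such that $(s,t)\mapsto\gamma(s,t)$ is smooth, $\gamma(0,\cdot)=c$ and $\partial_s\gamma(0,\cdot)=h$. Then for all $c\in\mathcal M$ and $h\in T_c\mathcal M$ such a path exists and $T_cR(h)$ is a well-defined element of $T_{R(c)}T\mathcal M$, independent of the path, and $G$ is the pullback of $\tilde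 G$ by $R$: $$G_c(h,k)=\tilde G_{R(c)}\big(T_cR(h),T_cR(k)\big)\qquad\text{for all }c\in\mathcal M,\ h,k\in T_c\mathcal M.$$ -/

import Mathlib

open Bundle Manifold MeasureTheory
open scoped ContDiff

noncomputable section

namespace SRV

section Connection

variable {E : Type*} [NormedAddCommGroup E] [NormedSpace ℝ E] [FiniteDimensional ℝ E]
  {H : Type*} [TopologicalSpace H] (I : ModelWithCorners ℝ E H)
  {M : Type*} [TopologicalSpace M] [ChartedSpace H M] [IsManifold I ∞ M]
  [RiemannianBundle (fun x : M => TangentSpace I x)]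

/-- The Gram form of the Riemannian metric at `x`, in the coordinates of the chart at `p`:
`(v, w) ↦ ∑ i j, g i j (x) * v i * w j`. Only its values for `x` near `p` are used. -/
def metricInChart (p x : M) : E →L[ℝ] E →L[ℝ] ℝ :=
  (innerSL ℝ : TangentSpace I x →L[ℝ] TangentSpace I x →L[ℝ] ℝ).bilinearComp
    ((trivializationAt E (TangentSpace I) p).symmL ℝ x)
    ((trivializationAt E (TangentSpace I) p).symmL ℝ x)

/-- The Christoffel symbols at `p` of the Levi-Civita connection in the chart at `p`: the vector
`Γ(v, w) = ∑ i j k, Γ^k_ij v i w j ∂_k` is determined by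
`⟨Γ(v, w), z⟩ = (∂_v g(w, z) + ∂_w g(v, z) - ∂_z g(v, w)) / 2` for all `z`. -/
def christoffel (p : M) (v w : TangentSpace I p) : TangentSpace I p :=
  letI e : TangentSpace I p →L[ℝ] E :=
    (trivializationAt E (TangentSpace I) p).continuousLinearMapAt ℝ p
  letI D : TangentSpace I p →L[ℝ] E →L[ℝ] E →L[ℝ] ℝ :=
    mfderiv I 𝓘(ℝ, E →L[ℝ] E →L[ℝ] ℝ) (metricInChart I p) p
  haveI : FiniteDimensional ℝ (TangentSpace I p) := inferInstanceAs (FiniteDimensional ℝ E)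
  haveI : CompleteSpace (TangentSpace I p) := FiniteDimensional.complete ℝ _
  (InnerProductSpace.toDual ℝ (TangentSpace I p)).symm
    ((1 / 2 : ℝ) • ((D v (e w)) ∘L e + (D w (e v)) ∘L e - (D.flip (e v)).flip (e w)))

/-- The formula that determines the Christoffel symbols. -/
lemma inner_christoffel (p : M) (v w z : TangentSpace I p) :
    letI e : TangentSpace I p →L[ℝ] E :=
      (trivializationAt E (TangentSpace I) p).continuousLinearMapAt ℝ p
    letI D : TangentSpace I p →L[ℝ] E →L[ℝ] E →L[ℝ] ℝ :=
      mfderiv I 𝓘(ℝ, E →L[ℝ] E →L[ℝ] ℝ) (metricInChart I p) p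
    inner ℝ (christoffel I p v w) z =
      (D v (e w) (e z) + D w (e v) (e z) - D z (e v) (e w)) / 2 := by
  have : FiniteDimensional ℝ (TangentSpace I p) := inferInstanceAs (FiniteDimensional ℝ E)
  have : CompleteSpace (TangentSpace I p) := FiniteDimensional.complete ℝ _
  unfold christoffel
  rw [InnerProductSpace.toDual_symm_apply]
  have key : ∀ a : ℝ, (1 / 2 : ℝ) * a = a / 2 := fun a => by ring
  exact key _

variable {I}

/-- The horizontal projection `T_(p,u) TM → T_p M`, the differential of `TM → M`. -/
def hp {u : TangentBundle I M} (ξ : TangentSpace I.tangent u) : TangentSpace I u.proj :=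
  mfderiv I.tangent I (TotalSpace.proj : TangentBundle I M → M) u ξ

/-- The vertical projection `T_(p,u) TM → T_p M` of the Levi-Civita connection. If `ξ` is the
velocity at time `0` of a curve `(x, U)` in `TM`, then in the chart at `p = x 0` this is
`(dU/dt)(0) + Γ(x'(0), U(0))`, the covariant derivative of `U` along `x` at time `0`. -/
def vp {u : TangentBundle I M} (ξ : TangentSpace I.tangent u) : TangentSpace I u.proj :=
  (trivializationAt E (TangentSpace I) u.proj).symmL ℝ u.proj
      (mfderiv I.tangent 𝓘(ℝ, E)
        (fun w : TangentBundle I M => (trivializationAt E (TangentSpace I) u.proj w).2) u ξ)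
    + christoffel I u.proj (hp ξ) u.snd

/-- The vertical projection of the velocity of a curve `U` in `TM` is the covariant derivative of
`U` along its base curve: the derivative of the components plus the Christoffel term. -/
lemma vp_velocity {U : ℝ → TangentBundle I M} {s : ℝ}
    (hU : MDifferentiableAt 𝓘(ℝ, ℝ) I.tangent U s) :
    vp (u := U s) (mfderiv 𝓘(ℝ, ℝ) I.tangent U s (1 : ℝ)) =
      (trivializationAt E (TangentSpace I) (U s).proj).symmL ℝ (U s).proj
        (deriv (fun r => (trivializationAt E (TangentSpace I) (U s).proj (U r)).2) s)
      + christoffel I (U s).proj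
          (mfderiv 𝓘(ℝ, ℝ) I (fun r => (U r).proj) s (1 : ℝ)) (U s).snd := by
  have h1 : MDifferentiableAt I.tangent I (TotalSpace.proj : TangentBundle I M → M) (U s) :=
    (Bundle.contMDiff_proj (n := 1) (TangentSpace I : M → Type _)).mdifferentiableAt one_ne_zero
  have h2 : MDifferentiableAt I.tangent 𝓘(ℝ, E) (fun w : TangentBundle I M =>
      (trivializationAt E (TangentSpace I) (U s).proj w).2) (U s) :=
    (Bundle.contMDiffAt_totalSpace.1 (contMDiffAt_id (n := 1) (I := I.tangent)
      (x := U s))).2.mdifferentiableAt one_ne_zero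
  have e1 : hp (u := U s) (mfderiv 𝓘(ℝ, ℝ) I.tangent U s (1 : ℝ))
      = mfderiv 𝓘(ℝ, ℝ) I (fun r => (U r).proj) s (1 : ℝ) :=
    (DFunLike.congr_fun (mfderiv_comp s h1 hU) (1 : ℝ)).symm
  have e2 := DFunLike.congr_fun (mfderiv_comp s h2 hU) (1 : ℝ)
  rw [mfderiv_eq_fderiv] at e2
  unfold vp
  rw [e1]
  congr 2
  exact e2.symm

end Connection

section Curves

variable {E : Type*} [NormedAddCommGroup E] [NormedSpace ℝ E]
  {H : Type*} [TopologicalSpace H] (I : ModelWithCorners ℝ E H)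
  (M : Type*) [TopologicalSpace M] [ChartedSpace H M] [IsManifold I ∞ M]

/-- The space of smooth immersions `c : [0,1] → M`. -/
structure Imm where
  toFun : unitInterval → M
  smooth : ContMDiff (𝓡∂ 1) I ∞ toFun
  immersive : ∀ t, mfderiv (𝓡∂ 1) I toFun t 1 ≠ 0

instance : CoeFun (Imm I M) (fun _ => unitInterval → M) := ⟨Imm.toFun⟩

variable {I M}

/-- The velocity `c'(t)`. -/
def Imm.vel (c : Imm I M) (t : unitInterval) : TangentSpace I (c t) :=
  mfderiv (𝓡∂ 1) I c t 1

/-- The tangent space to the space of immersions at `c`: smooth vector fields along `c`. -/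
structure TImm (c : Imm I M) where
  toFun : ∀ t : unitInterval, TangentSpace I (c t)
  smooth : ContMDiff (𝓡∂ 1) I.tangent ∞ (fun t => (⟨c t, toFun t⟩ : TangentBundle I M))

instance (c : Imm I M) : CoeFun (TImm c) (fun _ => ∀ t : unitInterval, TangentSpace I (c t)) :=
  ⟨TImm.toFun⟩

/-- A tangent vector `h` at `c`, seen as a curve in `TM`. -/
def TImm.curve {c : Imm I M} (h : TImm c) (t : unitInterval) : TangentBundle I M := ⟨c t, h t⟩

/-- The tangent space at `(c, h)` to the tangent bundle of the space of immersions: smooth vector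
fields along the curve `h` in `TM`. -/
structure TTImm {c : Imm I M} (h : TImm c) where
  toFun : ∀ t : unitInterval, TangentSpace I.tangent (h.curve t)
  smooth : ContMDiff (𝓡∂ 1) I.tangent.tangent ∞
    (fun t => (⟨h.curve t, toFun t⟩ : TangentBundle I.tangent (TangentBundle I M)))

instance {c : Imm I M} (h : TImm c) :
    CoeFun (TTImm h) (fun _ => ∀ t : unitInterval, TangentSpace I.tangent (h.curve t)) :=
  ⟨TTImm.toFun⟩

/-- `γ` is a path in the space of immersions, smooth for parameters `s` near `0`: the map
`(s, t) ↦ γ s t` is smooth. -/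
def IsSmoothPath (γ : ℝ → Imm I M) : Prop :=
  ∃ ε > 0, ContMDiffOn (𝓘(ℝ, ℝ).prod (𝓡∂ 1)) I ∞
    (fun q : ℝ × unitInterval => γ q.1 q.2) (Set.Ioo (-ε) ε ×ˢ Set.univ)

/-- The smooth path `γ` in the space of immersions passes through `c` at time `0` at speed `h`. -/
def Represents (γ : ℝ → Imm I M) (c : Imm I M) (h : TImm c) : Prop :=
  IsSmoothPath γ ∧ ∀ t : unitInterval,
    (⟨γ 0 t, mfderiv 𝓘(ℝ, ℝ) I (fun s : ℝ => γ s t) 0 (1 : ℝ)⟩ : TangentBundle I M) = h.curve t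

lemma contMDiff_vel (c : Imm I M) :
    ContMDiff (𝓡∂ 1) I.tangent ∞ (fun t => (⟨c t, c.vel t⟩ : TangentBundle I M)) := by
  have hf : ContMDiffOn 𝓘(ℝ, ℝ) I ∞ (c ∘ Set.projIcc (0 : ℝ) 1 zero_le_one) (Set.Icc 0 1) :=
    contMDiffOn_comp_projIcc_iff.2 c.smooth
  have hT := hf.contMDiffOn_tangentMapWithin (m := ∞) (by simp)
    (uniqueDiffOn_Icc zero_lt_one).uniqueMDiffOn
  have hs : ContMDiff (𝓡∂ 1) 𝓘(ℝ, ℝ).tangent ∞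
      (fun t : unitInterval => (⟨(t : ℝ), (1 : ℝ)⟩ : TangentBundle 𝓘(ℝ, ℝ) ℝ)) := by
    intro t
    rw [Bundle.contMDiffAt_totalSpace]
    refine ⟨contMDiff_subtypeVal_Icc.contMDiffAt, ?_⟩
    simpa using contMDiffAt_const
  have h := hT.comp_contMDiff hs (fun t => t.2)
  refine h.congr fun t => ?_
  refine TotalSpace.ext ?_ (heq_of_eq ?_)
  · exact congrArg c (Set.projIcc_val zero_le_one t).symm
  · exact (mfderivWithin_comp_projIcc_one (I := I) (f := c.toFun) (w := t)).symm

end Curves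

section Metrics

variable {E : Type*} [NormedAddCommGroup E] [NormedSpace ℝ E]
  {H : Type*} [TopologicalSpace H] {I : ModelWithCorners ℝ E H}
  {M : Type*} [TopologicalSpace M] [ChartedSpace H M] [IsManifold I ∞ M]
  [RiemannianBundle (fun x : M => TangentSpace I x)]
  [IsContMDiffRiemannianBundle I ∞ E (fun x : M => TangentSpace I x)]

lemma contMDiff_srvf (c : Imm I M) :
    ContMDiff (𝓡∂ 1) I.tangent ∞
      (fun t => (⟨c t, (√‖c.vel t‖)⁻¹ • c.vel t⟩ : TangentBundle I M)) := by
  have hv := contMDiff_vel c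
  have hi : ContMDiff (𝓡∂ 1) 𝓘(ℝ, ℝ) ∞ (fun t => inner ℝ (c.vel t) (c.vel t)) :=
    ContMDiff.inner_bundle hv hv
  have ha : ContMDiff (𝓡∂ 1) 𝓘(ℝ, ℝ) ∞ (fun t => (√‖c.vel t‖)⁻¹) := by
    intro t
    have hne : inner ℝ (c.vel t) (c.vel t) ≠ 0 := inner_self_ne_zero.2 (c.immersive t)
    have hg : ContDiffAt ℝ ∞ (fun x : ℝ => (√(√x))⁻¹) (inner ℝ (c.vel t) (c.vel t)) := by
      have h1 := Real.contDiffAt_sqrt (n := ∞) hne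
      have h0 : 0 < inner ℝ (c.vel t) (c.vel t) :=
        lt_of_le_of_ne real_inner_self_nonneg hne.symm
      exact (h1.sqrt (Real.sqrt_ne_zero'.2 h0)).inv
        (Real.sqrt_ne_zero'.2 (Real.sqrt_pos.2 h0))
    have := hg.contMDiffAt.comp t (hi t)
    refine this.congr_of_eventuallyEq (Filter.Eventually.of_forall fun x => ?_)
    simp only [Function.comp_apply, norm_eq_sqrt_real_inner]
  intro t
  have hvt := Bundle.contMDiffAt_totalSpace.1 (hv t)
  rw [Bundle.contMDiffAt_totalSpace]
  refine ⟨hvt.1, ?_⟩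
  refine ((ha t).smul hvt.2).congr_of_eventuallyEq ?_
  have hb : ∀ᶠ x in nhds t, c x ∈ (trivializationAt E (TangentSpace I) (c t)).baseSet :=
    c.smooth.continuous.continuousAt.eventually
      ((trivializationAt E (TangentSpace I) (c t)).open_baseSet.mem_nhds
        (mem_baseSet_trivializationAt E (TangentSpace I) (c t)))
  filter_upwards [hb] with x hx
  exact ((trivializationAt E (TangentSpace I) (c t)).linear ℝ hx).map_smul _ _

/-- The square root velocity function `R(c) = c' / √‖c'‖`. -/
def srvf (c : Imm I M) : TImm c := ⟨fun t => (√‖c.vel t‖)⁻¹ • c.vel t, contMDiff_srvf c⟩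

/-- `ξ` is the image `T_c R(h)` of `h` under the differential of the square root velocity function
at `c`: some path of immersions passes through `c` at speed `h`, and `R` maps each such path to a
path that passes through `R(c)` at speed `ξ`. -/
def IsTangentSRVF (c : Imm I M) (h : TImm c) (ξ : TTImm (srvf c)) : Prop :=
  (∃ γ : ℝ → Imm I M, Represents γ c h) ∧
  ∀ γ : ℝ → Imm I M, Represents γ c h → ∀ t : unitInterval,
    (⟨(srvf (γ 0)).curve t,
        mfderiv 𝓘(ℝ, ℝ) I.tangent (fun s : ℝ => (srvf (γ s)).curve t) 0 (1 : ℝ)⟩ :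
      TangentBundle I.tangent (TangentBundle I M)) = ⟨(srvf c).curve t, ξ t⟩

variable [FiniteDimensional ℝ E]

/-- `∇_ℓ h = ∇_{c'} h / ‖c'‖`, the covariant derivative of `h` along `c` according to arc length.
The covariant derivative `∇_{c'} h` is the vertical projection of the velocity of `h` in `TM`. -/
def covArc {c : Imm I M} (h : TImm c) (t : unitInterval) : TangentSpace I (c t) :=
  ‖c.vel t‖⁻¹ • vp (u := h.curve t) (mfderiv (𝓡∂ 1) I.tangent h.curve t 1)

/-- The tangential component `⟨∇_ℓ h, v⟩ v`, where `v = c' / ‖c'‖`. -/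
def covArcT {c : Imm I M} (h : TImm c) (t : unitInterval) : TangentSpace I (c t) :=
  inner ℝ (covArc h t) (‖c.vel t‖⁻¹ • c.vel t) • (‖c.vel t‖⁻¹ • c.vel t)

/-- The normal component of `∇_ℓ h`. -/
def covArcN {c : Imm I M} (h : TImm c) (t : unitInterval) : TangentSpace I (c t) :=
  covArc h t - covArcT h t

/-- The first-order Sobolev metric `G` on the space of immersions; arc length is
`dℓ = ‖c'(t)‖ dt`. -/
def G (c : Imm I M) (h k : TImm c) : ℝ :=
  inner ℝ (h 0) (k 0) +
    ∫ t : unitInterval, (inner ℝ (covArcN h t) (covArcN k t)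
      + 1 / 4 * inner ℝ (covArcT h t) (covArcT k t)) * ‖c.vel t‖

/-- The metric `G̃` on the tangent bundle of the space of immersions. -/
def GTilde {c : Imm I M} (h : TImm c) (ξ η : TTImm h) : ℝ :=
  inner ℝ (hp (ξ 0)) (hp (η 0)) + ∫ t : unitInterval, inner ℝ (vp (ξ t)) (vp (η t))

end Metrics

end SRV

end

/-!
Let `γ` be a path of immersions that passes through `c` at speed `h`. The curve `R(γ)` in `TM` lies
over `γ`, so the horizontal part of its velocity at time `0` is `h`. Its vertical part is
`∇_s (c' / √‖c'‖)`. Here `∇_s c' = ∇_{c'} h` because the connection is torsion-free, and the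
derivative of `‖c'‖` is `⟨∇_{c'} h, v⟩` because it is compatible with the metric, so the vertical
part is `√‖c'‖ (∇_ℓ h - (∇_ℓ h)ᵀ / 2)`. The halved tangential part accounts for the factor `1 / 4`
in `G`. A tangent vector of `TM` is determined by its horizontal and vertical parts, which therefore
makes `T_c R(h)` independent of the path.

A path with speed `h` exists: a partition of unity writes `h` as a sum of fields each supported in
one chart of `M`, and such fields can be added one after the other in coordinates. Compactness of
`[0, 1]` keeps the curves immersive for small times.
-/

noncomputable section

namespace SRV

open Filter Topology

section Smoothness

variable {E : Type*} [NormedAddCommGroup E] [NormedSpace ℝ E]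
  {H : Type*} [TopologicalSpace H] {I : ModelWithCorners ℝ E H}
  {M : Type*} [TopologicalSpace M] [ChartedSpace H M] [IsManifold I 1 M]

lemma contMDiffAt_mfderiv_apply {m n : WithTop ℕ∞}
    {EN : Type*} [NormedAddCommGroup EN] [NormedSpace ℝ EN]
    {HN : Type*} [TopologicalSpace HN] {J : ModelWithCorners ℝ EN HN}
    {N : Type*} [TopologicalSpace N] [ChartedSpace HN N] [IsManifold J 1 N]
    {EX : Type*} [NormedAddCommGroup EX] [NormedSpace ℝ EX]
    {HX : Type*} [TopologicalSpace HX] {K : ModelWithCorners ℝ EX HX}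
    {X : Type*} [TopologicalSpace X] [ChartedSpace HX X] [IsManifold K 1 X]
    {f : N → X → M} {g : N → X} {v : ∀ x, TangentSpace K (g x)} {x₀ : N}
    (hf : ContMDiffAt (J.prod K) I n (Function.uncurry f) (x₀, g x₀))
    (hv : ContMDiffAt J K.tangent m (fun x => (⟨g x, v x⟩ : TangentBundle K X)) x₀)
    (hmn : m + 1 ≤ n) :
    ContMDiffAt J I.tangent m
      (fun x => (⟨f x (g x), mfderiv K I (f x) (g x) (v x)⟩ : TangentBundle I M)) x₀ := by
  have hg : ContMDiffAt J K m g x₀ := (Bundle.contMDiffAt_totalSpace.1 hv).1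
  have hfg : ContMDiffAt J I m (fun x => f x (g x)) x₀ :=
    ContMDiffAt.comp (I' := J.prod K) x₀ (f := fun x => (x, g x))
      (hf.of_le (le_self_add.trans hmn)) (contMDiffAt_id.prodMk hg)
  exact ContMDiffAt.clm_apply_of_inCoordinates (hf.mfderiv f g hg hmn) hv hfg

lemma contMDiff_one_unitInterval :
    ContMDiff (𝓡∂ 1) (𝓡∂ 1).tangent ∞
      (fun t : unitInterval => (⟨t, 1⟩ : TangentBundle (𝓡∂ 1) unitInterval)) := by
  have hid (t : unitInterval) : mfderiv (𝓡∂ 1) (𝓡∂ 1) id t 1 = (1 : TangentSpace (𝓡∂ 1) t) := by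
    rw [mfderiv_id]; rfl
  have hne (t : unitInterval) : (1 : TangentSpace (𝓡∂ 1) t) ≠ 0 := fun h0 => by
    have h1 := mfderiv_subtypeVal_Icc_one t
    rw [h0, map_zero] at h1
    exact zero_ne_one (α := ℝ) h1
  have h := contMDiff_vel (I := 𝓡∂ 1) (M := unitInterval)
    ⟨id, contMDiff_id, fun t => (hid t).trans_ne (hne t)⟩
  exact h.congr fun t => congrArg _ (hid t).symm

lemma contMDiffAt_snd_velocity {Γ : ℝ × unitInterval → M} {q : ℝ × unitInterval}
    (hΓ : ContMDiffAt (𝓘(ℝ, ℝ).prod (𝓡∂ 1)) I ∞ Γ q) :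
    ContMDiffAt (𝓘(ℝ, ℝ).prod (𝓡∂ 1)) I.tangent ∞ (fun q : ℝ × unitInterval =>
      (⟨Γ q, mfderiv (𝓡∂ 1) I (fun t => Γ (q.1, t)) q.2 1⟩ : TangentBundle I M)) q := by
  refine contMDiffAt_mfderiv_apply (f := fun (q : ℝ × unitInterval) t => Γ (q.1, t)) (g := Prod.snd)
    (v := fun q => (1 : TangentSpace (𝓡∂ 1) q.2)) (n := ∞) ?_ ?_ (by simp)
  · exact hΓ.comp (q, q.2) (contMDiffAt_fst.fst.prodMk contMDiffAt_snd)
  · exact contMDiff_one_unitInterval.contMDiffAt.comp q contMDiffAt_snd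

lemma contMDiffAt_fst_velocity {EN : Type*} [NormedAddCommGroup EN] [NormedSpace ℝ EN]
    {HN : Type*} [TopologicalSpace HN] {J : ModelWithCorners ℝ EN HN}
    {N : Type*} [TopologicalSpace N] [ChartedSpace HN N] [IsManifold J 1 N]
    {Γ : ℝ × N → M} {q : ℝ × N} (hΓ : ContMDiffAt (𝓘(ℝ, ℝ).prod J) I ∞ Γ q) :
    ContMDiffAt (𝓘(ℝ, ℝ).prod J) I.tangent ∞ (fun q : ℝ × N =>
      (⟨Γ q, mfderiv 𝓘(ℝ, ℝ) I (fun s : ℝ => Γ (s, q.2)) q.1 (1 : ℝ)⟩ : TangentBundle I M)) q := by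
  refine contMDiffAt_mfderiv_apply (f := fun (q : ℝ × N) (s : ℝ) => Γ (s, q.2)) (g := Prod.fst)
    (v := fun _ => (1 : ℝ)) (n := ∞) ?_ ?_ (by simp)
  · exact ContMDiffAt.comp (q, q.1) hΓ (contMDiffAt_snd.prodMk contMDiffAt_fst.snd)
  · rw [Bundle.contMDiffAt_totalSpace]
    exact ⟨contMDiffAt_fst, by simpa using contMDiffAt_const⟩

end Smoothness

section MixedPartials

variable {E : Type*} [NormedAddCommGroup E] [NormedSpace ℝ E]

lemma hasDerivWithinAt_prodMk_left {F : ℝ × ℝ → E} {F' : ℝ × ℝ →L[ℝ] E} {S T : Set ℝ} {a b : ℝ}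
    (hF : HasFDerivWithinAt F F' (S ×ˢ T) (a, b)) (hb : b ∈ T) :
    HasDerivWithinAt (fun s => F (s, b)) (F' (1, 0)) S a :=
  hF.comp_hasDerivWithinAt a ((hasDerivAt_id a).prodMk (hasDerivAt_const a b)).hasDerivWithinAt
    (fun _ hs => Set.mk_mem_prod hs hb)

lemma hasDerivWithinAt_prodMk_right {F : ℝ × ℝ → E} {F' : ℝ × ℝ →L[ℝ] E} {S T : Set ℝ} {a b : ℝ}
    (hF : HasFDerivWithinAt F F' (S ×ˢ T) (a, b)) (ha : a ∈ S) :
    HasDerivWithinAt (fun t => F (a, t)) (F' (0, 1)) T b :=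
  hF.comp_hasDerivWithinAt b ((hasDerivAt_const b a).prodMk (hasDerivAt_id b)).hasDerivWithinAt
    (fun _ ht => Set.mk_mem_prod ha ht)

lemma derivWithin_derivWithin_comm {F : ℝ × ℝ → E} {S T : Set ℝ} {a b : ℝ}
    (hF : ContDiffWithinAt ℝ 2 F (S ×ˢ T) (a, b)) (hS : UniqueDiffOn ℝ S) (hT : UniqueDiffOn ℝ T)
    (hab : (a, b) ∈ closure (interior (S ×ˢ T))) (ha : a ∈ S) (hb : b ∈ T) :
    derivWithin (fun s => derivWithin (fun t => F (s, t)) T b) S a =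
      derivWithin (fun t => derivWithin (fun s => F (s, t)) S a) T b := by
  have hST : UniqueDiffOn ℝ (S ×ˢ T) := hS.prod hT
  have hmem : (a, b) ∈ S ×ˢ T := ⟨ha, hb⟩
  set F' := fderivWithin ℝ F (S ×ˢ T)
  have hF' : ∀ᶠ x in 𝓝[S ×ˢ T] (a, b), HasFDerivWithinAt F (F' x) (S ×ˢ T) x := by
    have h := hF.eventually (by simp)
    rw [Set.insert_eq_of_mem hmem] at h
    exact h.mono fun x hx => (hx.differentiableWithinAt (by simp)).hasFDerivWithinAt
  have hF'' : HasFDerivWithinAt F' (fderivWithin ℝ F' (S ×ˢ T) (a, b)) (S ×ˢ T) (a, b) :=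
    ((hF.fderivWithin_right hST (m := 1) (by norm_num) hmem).differentiableWithinAt
      one_ne_zero).hasFDerivWithinAt
  have hs : (fun s => derivWithin (fun t => F (s, t)) T b) =ᶠ[𝓝[S] a]
      fun s => F' (s, b) (0, 1) := by
    have h : Tendsto (fun s => (s, b)) (𝓝[S] a) (𝓝[S ×ˢ T] (a, b)) :=
      ((Continuous.prodMk_left b).continuousWithinAt).tendsto_nhdsWithin fun s hs => ⟨hs, hb⟩
    filter_upwards [h.eventually hF', self_mem_nhdsWithin] with s hs hsS
    exact (hasDerivWithinAt_prodMk_right hs hsS).derivWithin (hT b hb)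
  have ht : (fun t => derivWithin (fun s => F (s, t)) S a) =ᶠ[𝓝[T] b]
      fun t => F' (a, t) (1, 0) := by
    have h : Tendsto (fun t => (a, t)) (𝓝[T] b) (𝓝[S ×ˢ T] (a, b)) :=
      ((Continuous.prodMk_right a).continuousWithinAt).tendsto_nhdsWithin fun t ht => ⟨ha, ht⟩
    filter_upwards [h.eventually hF', self_mem_nhdsWithin] with t ht htT
    exact (hasDerivWithinAt_prodMk_left ht htT).derivWithin (hS a ha)
  rw [hs.derivWithin_eq_of_mem ha, ht.derivWithin_eq_of_mem hb,
    ((hasDerivWithinAt_prodMk_left hF'' hb).clm_apply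
      (hasDerivWithinAt_const a S (0, 1))).derivWithin (hS a ha),
    ((hasDerivWithinAt_prodMk_right hF'' ha).clm_apply
      (hasDerivWithinAt_const b T (1, 0))).derivWithin (hT b hb), map_zero, add_zero,
    add_zero]
  exact (hF.isSymmSndFDerivWithinAt (by simp) hST hab hmem).eq _ _

lemma mvfderiv_one_eq_deriv (g : ℝ → E) (s : ℝ) : mvfderiv 𝓘(ℝ, ℝ) g s (1 : ℝ) = deriv g s := by
  have h : mvfderiv 𝓘(ℝ, ℝ) g s = fderiv ℝ g s := mfderiv_eq_fderiv
  rw [h]; rfl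

variable {x y : ℝ} [Fact (x < y)]

lemma mvfderiv_one_eq_derivWithin (g : Set.Icc x y → E) (t : Set.Icc x y) :
    mvfderiv (𝓡∂ 1) g t 1 =
      derivWithin (g ∘ Set.projIcc x y (Fact.out : x < y).le) (Set.Icc x y) t := by
  have h : mvfderiv (𝓡∂ 1) g t 1 = _ := (mfderivWithin_comp_projIcc_one (w := t)).symm
  rw [h, mfderivWithin_eq_fderivWithin]
  rfl

lemma mvfderiv_mvfderiv_comm {f : ℝ × Set.Icc x y → E} {q : ℝ × Set.Icc x y}
    (hf : ContMDiffAt (𝓘(ℝ, ℝ).prod (𝓡∂ 1)) 𝓘(ℝ, E) 2 f q) :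
    mvfderiv 𝓘(ℝ, ℝ) (fun s : ℝ => mvfderiv (𝓡∂ 1) (fun t => f (s, t)) q.2 1) q.1 (1 : ℝ) =
      mvfderiv (𝓡∂ 1) (fun t => mvfderiv 𝓘(ℝ, ℝ) (fun s : ℝ => f (s, t)) q.1 (1 : ℝ)) q.2 1 := by
  obtain ⟨a, t⟩ := q
  have hxy : x < y := Fact.out
  let proj : ℝ → Set.Icc x y := Set.projIcc x y hxy.le
  have hF : ContDiffWithinAt ℝ 2 (fun q : ℝ × ℝ => f (q.1, proj q.2)) (Set.univ ×ˢ Set.Icc x y)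
      (a, t) := by
    rw [← contMDiffWithinAt_iff_contDiffWithinAt]
    have hfst : ContMDiffWithinAt 𝓘(ℝ, ℝ × ℝ) 𝓘(ℝ, ℝ) 2 (Prod.fst : ℝ × ℝ → ℝ)
        (Set.univ ×ˢ Set.Icc x y) (a, t) := contDiff_fst.contMDiff.contMDiffAt.contMDiffWithinAt
    have hsnd : ContMDiffWithinAt 𝓘(ℝ, ℝ × ℝ) (𝓡∂ 1) 2 (fun q : ℝ × ℝ => proj q.2)
        (Set.univ ×ˢ Set.Icc x y) (a, t) :=
      (contMDiffOn_projIcc (t : ℝ) t.2).comp ((a, t) : ℝ × ℝ)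
        contDiff_snd.contMDiff.contMDiffAt.contMDiffWithinAt fun q hq => hq.2
    exact ContMDiffAt.comp_contMDiffWithinAt_of_eq hf (hfst.prodMk hsnd)
      (Prod.ext rfl (Set.projIcc_val hxy.le t))
  have hat : ((a, t) : ℝ × ℝ) ∈ closure (interior (Set.univ ×ˢ Set.Icc x y)) := by
    rw [interior_prod_eq, interior_univ, closure_prod_eq, interior_Icc, closure_Ioo hxy.ne,
      closure_univ]
    exact ⟨trivial, t.2⟩
  have h := derivWithin_derivWithin_comm hF uniqueDiffOn_univ (uniqueDiffOn_Icc hxy) hat trivial t.2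
  simp only [derivWithin_univ] at h
  simp only [mvfderiv_one_eq_deriv, mvfderiv_one_eq_derivWithin]
  exact h

end MixedPartials

section Trivialization

variable {E : Type*} [NormedAddCommGroup E] [NormedSpace ℝ E]
  {H : Type*} [TopologicalSpace H] {I : ModelWithCorners ℝ E H}
  {M : Type*} [TopologicalSpace M] [ChartedSpace H M] [IsManifold I 1 M]

lemma trivializationAt_snd {p x : M} (v : TangentSpace I x)
    (hx : x ∈ (trivializationAt E (TangentSpace I) p).baseSet) :
    (trivializationAt E (TangentSpace I) p (⟨x, v⟩ : TangentBundle I M)).2 =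
      (trivializationAt E (TangentSpace I) p).continuousLinearMapAt ℝ x v := by
  rw [Trivialization.continuousLinearMapAt_apply, Trivialization.linearMapAt_apply, if_pos hx]

lemma trivializationAt_snd_eq_mfderiv {p x : M} (v : TangentSpace I x)
    (hx : x ∈ (chartAt H p).source) :
    (trivializationAt E (TangentSpace I) p (⟨x, v⟩ : TangentBundle I M)).2 =
      mfderiv I 𝓘(ℝ, E) (extChartAt I p) x v := by
  rw [trivializationAt_snd v hx, TangentBundle.continuousLinearMapAt_trivializationAt hx]
  rfl

lemma symmL_trivializationAt_snd {p x : M} (v : TangentSpace I x)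
    (hx : x ∈ (trivializationAt E (TangentSpace I) p).baseSet) :
    (trivializationAt E (TangentSpace I) p).symmL ℝ x
      (trivializationAt E (TangentSpace I) p (⟨x, v⟩ : TangentBundle I M)).2 = v := by
  rw [trivializationAt_snd v hx, Trivialization.symmL_continuousLinearMapAt _ hx]

variable {EX : Type*} [NormedAddCommGroup EX] [NormedSpace ℝ EX]
  {HX : Type*} [TopologicalSpace HX] {K : ModelWithCorners ℝ EX HX}
  {X : Type*} [TopologicalSpace X] [ChartedSpace HX X]
  {b : X → M} {v : ∀ x, TangentSpace I (b x)} {a : X → ℝ} {x : X}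

lemma eventually_trivializationAt_snd_smul (hb : ContinuousAt b x) (a : X → ℝ)
    (v : ∀ x, TangentSpace I (b x)) :
    (fun y => (trivializationAt E (TangentSpace I) (b x)
      (⟨b y, a y • v y⟩ : TangentBundle I M)).2) =ᶠ[𝓝 x]
    fun y => a y • (trivializationAt E (TangentSpace I) (b x)
      (⟨b y, v y⟩ : TangentBundle I M)).2 := by
  have hmem := FiberBundle.mem_baseSet_trivializationAt' (F := E) (E := TangentSpace I) (b x)
  filter_upwards [hb.eventually
    ((trivializationAt E (TangentSpace I) (b x)).open_baseSet.mem_nhds hmem)] with y hy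
  exact ((trivializationAt E (TangentSpace I) (b x)).linear ℝ hy).map_smul _ _

lemma contMDiffAt_smul_along {n : WithTop ℕ∞} (ha : ContMDiffAt K 𝓘(ℝ, ℝ) n a x)
    (hv : ContMDiffAt K I.tangent n (fun y => (⟨b y, v y⟩ : TangentBundle I M)) x) :
    ContMDiffAt K I.tangent n (fun y => (⟨b y, a y • v y⟩ : TangentBundle I M)) x := by
  rw [Bundle.contMDiffAt_totalSpace] at hv ⊢
  exact ⟨hv.1, (ha.smul hv.2).congr_of_eventuallyEq
    (eventually_trivializationAt_snd_smul hv.1.continuousAt a v)⟩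

lemma mdifferentiableAt_smul_along (ha : MDifferentiableAt K 𝓘(ℝ, ℝ) a x)
    (hv : MDifferentiableAt K I.tangent (fun y => (⟨b y, v y⟩ : TangentBundle I M)) x) :
    MDifferentiableAt K I.tangent (fun y => (⟨b y, a y • v y⟩ : TangentBundle I M)) x := by
  rw [mdifferentiableAt_totalSpace] at hv ⊢
  exact ⟨hv.1, (ha.smul hv.2).congr_of_eventuallyEq
    (eventually_trivializationAt_snd_smul hv.1.continuousAt a v)⟩

lemma hasDerivAt_comp_of_mdifferentiableAt {F : Type*} [NormedAddCommGroup F] [NormedSpace ℝ F]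
    {A : X → F} {y : ℝ → X} {s : ℝ} (hA : MDifferentiableAt K 𝓘(ℝ, F) A (y s))
    (hy : MDifferentiableAt 𝓘(ℝ, ℝ) K y s) :
    HasDerivAt (fun r => A (y r)) (mvfderiv K A (y s) (mfderiv 𝓘(ℝ, ℝ) K y s (1 : ℝ))) s := by
  have h : HasDerivAt (fun r => A (y r)) _ s := (hA.comp s hy).differentiableAt.hasDerivAt
  exact h.congr_deriv ((mvfderiv_one_eq_deriv _ s).symm.trans (mfderiv_comp_apply s hA hy (1 : ℝ)))

lemma hasDerivAt_bilin_comp {F G : Type*} [NormedAddCommGroup F] [NormedSpace ℝ F]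
    [NormedAddCommGroup G] [NormedSpace ℝ G] {A : X → F →L[ℝ] F →L[ℝ] G} {y : ℝ → X}
    {f g : ℝ → F} {f' g' : F} {s : ℝ} (hA : MDifferentiableAt K 𝓘(ℝ, F →L[ℝ] F →L[ℝ] G) A (y s))
    (hy : MDifferentiableAt 𝓘(ℝ, ℝ) K y s) (hf : HasDerivAt f f' s) (hg : HasDerivAt g g' s) :
    HasDerivAt (fun r => A (y r) (f r) (g r))
      (mvfderiv K A (y s) (mfderiv 𝓘(ℝ, ℝ) K y s (1 : ℝ)) (f s) (g s)
        + A (y s) f' (g s) + A (y s) (f s) g') s := by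
  have h := ((hasDerivAt_comp_of_mdifferentiableAt hA hy).clm_apply hf).clm_apply hg
  rwa [add_apply] at h

lemma mvfderiv_clm_apply_const {F G : Type*} [NormedAddCommGroup F] [NormedSpace ℝ F]
    [NormedAddCommGroup G] [NormedSpace ℝ G] {A : X → F →L[ℝ] G}
    (hA : MDifferentiableAt K 𝓘(ℝ, F →L[ℝ] G) A x) (ζ : TangentSpace K x) (v : F) :
    mvfderiv K (fun y => A y v) x ζ = mvfderiv K A x ζ v := by
  have hL := ((ContinuousLinearMap.apply ℝ G v).hasFDerivAt (x := A x)).hasMFDerivAt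
  exact DFunLike.congr_fun (hL.comp x hA.hasMFDerivAt).mfderiv ζ

end Trivialization

section Connection

variable {E : Type*} [NormedAddCommGroup E] [NormedSpace ℝ E]
  {H : Type*} [TopologicalSpace H] {I : ModelWithCorners ℝ E H}
  {M : Type*} [TopologicalSpace M] [ChartedSpace H M] [IsManifold I ∞ M]
  [RiemannianBundle (fun x : M => TangentSpace I x)]

lemma metricInChart_comm (p x : M) (v w : E) :
    metricInChart I p x v w = metricInChart I p x w v :=
  real_inner_comm (F := TangentSpace I x) _ _

lemma metricInChart_trivializationAt_right {p x : M}
    (hx : x ∈ (trivializationAt E (TangentSpace I) p).baseSet) (v : E) (w : TangentSpace I x) :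
    metricInChart I p x v (trivializationAt E (TangentSpace I) p (⟨x, w⟩ : TangentBundle I M)).2 =
      inner ℝ ((trivializationAt E (TangentSpace I) p).symmL ℝ x v) w :=
  congrArg (inner ℝ _) (symmL_trivializationAt_snd w hx)

lemma metricInChart_trivializationAt {p x : M}
    (hx : x ∈ (trivializationAt E (TangentSpace I) p).baseSet) (v w : TangentSpace I x) :
    metricInChart I p x (trivializationAt E (TangentSpace I) p (⟨x, v⟩ : TangentBundle I M)).2
      (trivializationAt E (TangentSpace I) p (⟨x, w⟩ : TangentBundle I M)).2 = inner ℝ v w := by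
  rw [metricInChart_trivializationAt_right hx, symmL_trivializationAt_snd v hx]

lemma contMDiffAt_metricInChart {n : WithTop ℕ∞}
    [IsContMDiffRiemannianBundle I n E (fun x : M => TangentSpace I x)] (p : M) :
    ContMDiffAt I 𝓘(ℝ, E →L[ℝ] E →L[ℝ] ℝ) n (metricInChart I p) p := by
  obtain ⟨g, hg, hinner⟩ := IsContMDiffRiemannianBundle.exists_contMDiff (IB := I) (n := n)
    (F := E) (E := fun x : M => TangentSpace I x)
  have hmem := FiberBundle.mem_baseSet_trivializationAt' (F := E) (E := TangentSpace I) p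
  refine ((contMDiffAt_hom_bundle _).1 (hg p)).2.congr_of_eventuallyEq ?_
  filter_upwards [(trivializationAt E (TangentSpace I) p).open_baseSet.mem_nhds hmem] with x hx
  ext v w
  rw [inCoordinates_apply_eq₂ hx hx (Set.mem_univ x)]
  simp only [metricInChart, ContinuousLinearMap.bilinearComp_apply,
    Trivialization.symmL_apply _ hx, coe_innerSL_apply, Trivial.fiberBundle_trivializationAt',
    Trivial.linearMapAt_trivialization, ← hinner, LinearMap.id_coe, id_eq]

/-- The derivative at `p` of the Gram form of the metric in the chart at `p`, from which the
Christoffel symbols are made. -/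
def dMetric (I : ModelWithCorners ℝ E H) {M : Type*} [TopologicalSpace M] [ChartedSpace H M]
    [IsManifold I ∞ M] [RiemannianBundle (fun x : M => TangentSpace I x)] (p : M) :
    TangentSpace I p →L[ℝ] E →L[ℝ] E →L[ℝ] ℝ :=
  mvfderiv I (metricInChart I p) p

section

variable [IsContMDiffRiemannianBundle I ∞ E (fun x : M => TangentSpace I x)]

lemma mdifferentiableAt_metricInChart (p : M) :
    MDifferentiableAt I 𝓘(ℝ, E →L[ℝ] E →L[ℝ] ℝ) (metricInChart I p) p :=
  (contMDiffAt_metricInChart (n := ∞) p).mdifferentiableAt (by simp)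

lemma dMetric_comm (p : M) (z : TangentSpace I p) (v w : E) :
    dMetric I p z v w = dMetric I p z w v := by
  have h (v w : E) : dMetric I p z v w = mvfderiv I (fun x => metricInChart I p x v w) p z := by
    have hA := mdifferentiableAt_metricInChart (I := I) p
    rw [mvfderiv_clm_apply_const (hA.clm_apply mdifferentiableAt_const),
      mvfderiv_clm_apply_const hA, dMetric]
  simp only [h v w, h w v, metricInChart_comm p _ v w]

end

end Connection

section CovariantDerivative

variable {E : Type*} [NormedAddCommGroup E] [NormedSpace ℝ E]
  {H : Type*} [TopologicalSpace H] {I : ModelWithCorners ℝ E H}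
  {M : Type*} [TopologicalSpace M] [ChartedSpace H M] [IsManifold I ∞ M]
  {EX : Type*} [NormedAddCommGroup EX] [NormedSpace ℝ EX]
  {HX : Type*} [TopologicalSpace HX] {K : ModelWithCorners ℝ EX HX}
  {X : Type*} [TopologicalSpace X] [ChartedSpace HX X]
  {b : X → M} {v : ∀ x, TangentSpace I (b x)} {x : X}

lemma hp_mfderiv {U : X → TangentBundle I M} (hU : MDifferentiableAt K I.tangent U x)
    (ζ : TangentSpace K x) :
    hp (u := U x) (mfderiv K I.tangent U x ζ) = mfderiv K I (fun y => (U y).proj) x ζ :=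
  (DFunLike.congr_fun (mfderiv_comp x (mdifferentiableAt_proj (TangentSpace I)) hU) ζ).symm

lemma mdifferentiableAt_trivializationAt_snd {u : TangentBundle I M} :
    MDifferentiableAt I.tangent 𝓘(ℝ, E)
      (fun w : TangentBundle I M => (trivializationAt E (TangentSpace I) u.proj w).2) u :=
  ((mdifferentiableAt_totalSpace _ _).1 (mdifferentiableAt_id (I := I.tangent) (x := u))).2

variable [FiniteDimensional ℝ E] [RiemannianBundle (fun x : M => TangentSpace I x)]

lemma inner_christoffel_eq (p : M) (v w z : TangentSpace I p) :
    letI e : TangentSpace I p →L[ℝ] E :=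
      (trivializationAt E (TangentSpace I) p).continuousLinearMapAt ℝ p
    inner ℝ (christoffel I p v w) z =
      (dMetric I p v (e w) (e z) + dMetric I p w (e v) (e z) - dMetric I p z (e v) (e w)) / 2 :=
  inner_christoffel I p v w z

lemma christoffel_smul (p : M) (v w : TangentSpace I p) (a : ℝ) :
    christoffel I p v (a • w) = a • christoffel I p v w := by
  refine ext_inner_right ℝ fun z => ?_
  rw [real_inner_smul_left, inner_christoffel_eq, inner_christoffel_eq]
  simp only [ContinuousLinearMap.map_smul, smul_apply, smul_eq_mul]
  ring

/-- The covariant derivative at `x`, in the direction `ζ`, of the vector field `v` along `b`. -/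
def covDeriv (K : ModelWithCorners ℝ EX HX) (b : X → M) (v : ∀ x, TangentSpace I (b x)) (x : X)
    (ζ : TangentSpace K x) : TangentSpace I (b x) :=
  vp (u := ⟨b x, v x⟩)
    (mfderiv K I.tangent (fun y => (⟨b y, v y⟩ : TangentBundle I M)) x ζ)

lemma covDeriv_eq (hv : MDifferentiableAt K I.tangent (fun y => (⟨b y, v y⟩ : TangentBundle I M)) x)
    (ζ : TangentSpace K x) :
    covDeriv K b v x ζ = (trivializationAt E (TangentSpace I) (b x)).symmL ℝ (b x)
        (mvfderiv K (fun y => (trivializationAt E (TangentSpace I) (b x)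
          (⟨b y, v y⟩ : TangentBundle I M)).2) x ζ)
      + christoffel I (b x) (mfderiv K I b x ζ) (v x) := by
  rw [covDeriv, vp, hp_mfderiv hv]
  congr 2
  exact (DFunLike.congr_fun (mfderiv_comp x mdifferentiableAt_trivializationAt_snd hv) ζ).symm

lemma covDeriv_smul {a : X → ℝ} (ha : MDifferentiableAt K 𝓘(ℝ, ℝ) a x)
    (hv : MDifferentiableAt K I.tangent (fun y => (⟨b y, v y⟩ : TangentBundle I M)) x)
    (ζ : TangentSpace K x) :
    covDeriv K b (fun y => a y • v y) x ζ =
      mvfderiv K a x ζ • v x + a x • covDeriv K b v x ζ := by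
  obtain ⟨hb, hy⟩ := (mdifferentiableAt_totalSpace _ _).1 hv
  have hmem := FiberBundle.mem_baseSet_trivializationAt' (F := E) (E := TangentSpace I) (b x)
  have hcoord : mvfderiv K (fun y => (trivializationAt E (TangentSpace I) (b x)
      (⟨b y, a y • v y⟩ : TangentBundle I M)).2) x = _ :=
    (eventually_trivializationAt_snd_smul hb.continuousAt a v).mfderiv_eq.trans
      (mvfderiv_smul (F := E) ha hy)
  rw [covDeriv_eq (mdifferentiableAt_smul_along ha hv), covDeriv_eq hv, christoffel_smul, hcoord]
  simp only [add_apply, smul_apply, ContinuousLinearMap.smulRight_apply, map_add, map_smul,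
    symmL_trivializationAt_snd _ hmem]
  module

lemma eq_of_hp_eq_of_vp_eq {u : TangentBundle I M} {ξ η : TangentSpace I.tangent u}
    (hh : hp ξ = hp η) (hv : vp ξ = vp η) : ξ = η := by
  set e := trivializationAt E (TangentSpace I) u.proj
  have hu : u.proj ∈ e.baseSet := mem_baseSet_trivializationAt E (TangentSpace I) u.proj
  have hsnd : mfderiv I.tangent 𝓘(ℝ, E) (fun w : TangentBundle I M => (e w).2) u ξ =
      mfderiv I.tangent 𝓘(ℝ, E) (fun w : TangentBundle I M => (e w).2) u η := by
    unfold vp at hv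
    rw [hh] at hv
    have h := congrArg (e.continuousLinearMapAt ℝ u.proj) (add_right_cancel hv)
    exact (e.continuousLinearMapAt_symmL hu _).symm.trans
      (h.trans (e.continuousLinearMapAt_symmL hu _))
  have hpair : mfderiv I.tangent (I.prod 𝓘(ℝ, E)) e u =
      (mfderiv I.tangent I TotalSpace.proj u).prod
        (mfderiv I.tangent 𝓘(ℝ, E) (fun w : TangentBundle I M => (e w).2) u) := by
    rw [← mfderiv_prodMk (mdifferentiableAt_proj _) mdifferentiableAt_trivializationAt_snd]
    refine Filter.EventuallyEq.mfderiv_eq ?_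
    filter_upwards [e.open_source.mem_nhds (e.mem_source.2 hu)] with w hw
    exact Prod.ext (e.coe_fst hw) rfl
  refine (e.mdifferentiable (TangentSpace I)).mfderiv_injective (e.mem_source.2 hu) ?_
  exact (DFunLike.congr_fun hpair ξ).trans
    ((Prod.ext hh hsnd).trans (DFunLike.congr_fun hpair η).symm)

variable [IsContMDiffRiemannianBundle I ∞ E (fun x : M => TangentSpace I x)]

lemma christoffel_comm (p : M) (v w : TangentSpace I p) :
    christoffel I p v w = christoffel I p w v := by
  refine ext_inner_right ℝ fun z => ?_
  rw [inner_christoffel_eq, inner_christoffel_eq, dMetric_comm p z]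
  ring

lemma inner_christoffel_add_inner_christoffel (p : M) (z v w : TangentSpace I p) :
    letI e : TangentSpace I p →L[ℝ] E :=
      (trivializationAt E (TangentSpace I) p).continuousLinearMapAt ℝ p
    inner ℝ (christoffel I p z v) w + inner ℝ v (christoffel I p z w) =
      dMetric I p z (e v) (e w) := by
  rw [real_inner_comm _ v, inner_christoffel_eq, inner_christoffel_eq]
  simp only [dMetric_comm p z]
  ring

lemma hasDerivAt_inner_of_mdifferentiableAt {b : ℝ → M} {v w : ∀ s, TangentSpace I (b s)} {s : ℝ}
    (hv : MDifferentiableAt 𝓘(ℝ, ℝ) I.tangent (fun r => (⟨b r, v r⟩ : TangentBundle I M)) s)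
    (hw : MDifferentiableAt 𝓘(ℝ, ℝ) I.tangent (fun r => (⟨b r, w r⟩ : TangentBundle I M)) s) :
    HasDerivAt (fun r => inner ℝ (v r) (w r))
      (inner ℝ (covDeriv 𝓘(ℝ, ℝ) b v s (1 : ℝ)) (w s) +
        inner ℝ (v s) (covDeriv 𝓘(ℝ, ℝ) b w s (1 : ℝ))) s := by
  obtain ⟨hb, hcv⟩ := (mdifferentiableAt_totalSpace _ _).1 hv
  have hcw := ((mdifferentiableAt_totalSpace _ _).1 hw).2
  dsimp only at hb hcv hcw
  rw [mdifferentiableAt_iff_differentiableAt] at hcv hcw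
  have hmem := mem_baseSet_trivializationAt E (TangentSpace I) (b s)
  have hinner : (fun r => inner ℝ (v r) (w r)) =ᶠ[𝓝 s] fun r => metricInChart I (b s) (b r)
      (trivializationAt E (TangentSpace I) (b s) (⟨b r, v r⟩ : TangentBundle I M)).2
      (trivializationAt E (TangentSpace I) (b s) (⟨b r, w r⟩ : TangentBundle I M)).2 := by
    filter_upwards [hb.continuousAt.eventually
      ((trivializationAt E (TangentSpace I) (b s)).open_baseSet.mem_nhds hmem)] with r hr
    exact (metricInChart_trivializationAt hr _ _).symm
  refine ((hasDerivAt_bilin_comp (mdifferentiableAt_metricInChart (b s)) hb hcv.hasDerivAt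
    hcw.hasDerivAt).congr_of_eventuallyEq hinner).congr_deriv ?_
  rw [covDeriv_eq hv (1 : ℝ), covDeriv_eq hw (1 : ℝ), mvfderiv_one_eq_deriv,
    mvfderiv_one_eq_deriv, inner_add_left, inner_add_right, add_add_add_comm,
    inner_christoffel_add_inner_christoffel, metricInChart_trivializationAt_right hmem,
    metricInChart_comm, metricInChart_trivializationAt_right hmem, real_inner_comm (v s),
    trivializationAt_snd _ hmem, trivializationAt_snd _ hmem, dMetric]
  ring

end CovariantDerivative

section TorsionFree

variable {E : Type*} [NormedAddCommGroup E] [NormedSpace ℝ E]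
  {H : Type*} [TopologicalSpace H] {I : ModelWithCorners ℝ E H}
  {M : Type*} [TopologicalSpace M] [ChartedSpace H M]

lemma trivializationAt_snd_mfderiv [IsManifold I 1 M]
    {EX : Type*} [NormedAddCommGroup EX] [NormedSpace ℝ EX]
    {HX : Type*} [TopologicalSpace HX] {K : ModelWithCorners ℝ EX HX}
    {X : Type*} [TopologicalSpace X] [ChartedSpace HX X]
    {f : X → M} {x : X} {p : M} (hf : MDifferentiableAt K I f x)
    (hx : f x ∈ (chartAt H p).source) (ζ : TangentSpace K x) :
    (trivializationAt E (TangentSpace I) p (⟨f x, mfderiv K I f x ζ⟩ : TangentBundle I M)).2 =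
      mvfderiv K (fun y => extChartAt I p (f y)) x ζ := by
  rw [trivializationAt_snd_eq_mfderiv _ hx]
  exact (mfderiv_comp_apply x (mdifferentiableAt_extChartAt hx) hf ζ).symm

variable [IsManifold I ∞ M] [FiniteDimensional ℝ E]
  [RiemannianBundle (fun x : M => TangentSpace I x)]
  [IsContMDiffRiemannianBundle I ∞ E (fun x : M => TangentSpace I x)]

lemma covDeriv_velocity_comm {Γ : ℝ × unitInterval → M} {q : ℝ × unitInterval}
    (hΓ : ContMDiffAt (𝓘(ℝ, ℝ).prod (𝓡∂ 1)) I ∞ Γ q) :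
    covDeriv 𝓘(ℝ, ℝ) (fun s => Γ (s, q.2)) (fun s => mfderiv (𝓡∂ 1) I (fun t => Γ (s, t)) q.2 1)
        q.1 (1 : ℝ) =
      covDeriv (𝓡∂ 1) (fun t => Γ (q.1, t))
        (fun t => mfderiv 𝓘(ℝ, ℝ) I (fun s => Γ (s, t)) q.1 (1 : ℝ)) q.2 1 := by
  have hs : Tendsto (fun s : ℝ => (s, q.2)) (𝓝 q.1) (𝓝 q) :=
    (Continuous.prodMk_left q.2).tendsto q.1
  have ht : Tendsto (fun t : unitInterval => (q.1, t)) (𝓝 q.2) (𝓝 q) :=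
    (Continuous.prodMk_right q.1).tendsto q.2
  have hnear : ∀ᶠ r in 𝓝 q, Γ r ∈ (chartAt H (Γ q)).source ∧
      ContMDiffAt (𝓘(ℝ, ℝ).prod (𝓡∂ 1)) I 1 Γ r :=
    (hΓ.continuousAt.eventually (chart_source_mem_nhds H _)).and
      ((contMDiffAt_iff_contMDiffAt_nhds (by simp)).1 (hΓ.of_le ENat.LEInfty.out))
  have hsnd : (fun s => (trivializationAt E (TangentSpace I) (Γ q)
      (⟨Γ (s, q.2), mfderiv (𝓡∂ 1) I (fun t => Γ (s, t)) q.2 1⟩ : TangentBundle I M)).2) =ᶠ[𝓝 q.1]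
      fun s => mvfderiv (𝓡∂ 1) (fun t => extChartAt I (Γ q) (Γ (s, t))) q.2 1 := by
    filter_upwards [hs.eventually hnear] with s ⟨hsrc, hsmooth⟩
    exact trivializationAt_snd_mfderiv ((hsmooth.comp q.2
      (contMDiffAt_const.prodMk contMDiffAt_id)).mdifferentiableAt one_ne_zero) hsrc 1
  have hfst : (fun t => (trivializationAt E (TangentSpace I) (Γ q)
      (⟨Γ (q.1, t), mfderiv 𝓘(ℝ, ℝ) I (fun s => Γ (s, t)) q.1 (1 : ℝ)⟩ : TangentBundle I M)).2)
      =ᶠ[𝓝 q.2] fun t => mvfderiv 𝓘(ℝ, ℝ) (fun s => extChartAt I (Γ q) (Γ (s, t))) q.1 (1 : ℝ) := by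
    filter_upwards [ht.eventually hnear] with t ⟨hsrc, hsmooth⟩
    exact trivializationAt_snd_mfderiv ((ContMDiffAt.comp q.1 hsmooth
      (contMDiffAt_id.prodMk contMDiffAt_const)).mdifferentiableAt one_ne_zero) hsrc (1 : ℝ)
  have hchart : ContMDiffAt (𝓘(ℝ, ℝ).prod (𝓡∂ 1)) 𝓘(ℝ, E) 2
      (fun r => extChartAt I (Γ q) (Γ r)) q :=
    (contMDiffAt_extChartAt.comp q hΓ).of_le ENat.LEInfty.out
  have hU₁ := ((contMDiffAt_snd_velocity hΓ).comp_of_eq (x := q.1)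
    (contMDiffAt_id.prodMk contMDiffAt_const) rfl).mdifferentiableAt (n := ∞) (by simp)
  have hU₂ := ((contMDiffAt_fst_velocity hΓ).comp_of_eq (x := q.2)
    (contMDiffAt_const.prodMk contMDiffAt_id) rfl).mdifferentiableAt (n := ∞) (by simp)
  refine (covDeriv_eq hU₁ (1 : ℝ)).trans (Eq.trans ?_ (covDeriv_eq hU₂ 1).symm)
  rw [christoffel_comm]
  refine congrArg₂ (· + ·) (congrArg _ ?_) rfl
  exact (DFunLike.congr_fun hsnd.mfderiv_eq (1 : ℝ)).trans
    ((mvfderiv_mvfderiv_comm hchart).trans (DFunLike.congr_fun hfst.mfderiv_eq 1).symm)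

end TorsionFree

section ChartAddition

variable {E : Type*} [NormedAddCommGroup E] [NormedSpace ℝ E]
  {H : Type*} [TopologicalSpace H] {I : ModelWithCorners ℝ E H}
  {M : Type*} [TopologicalSpace M] [ChartedSpace H M]

variable (I) in
open Classical in
/-- The point whose coordinates in the chart at `p` are those of `x` plus `w`. Outside the domain of
the chart it is `x`, so that adding `0` never moves a point. -/
def addInChart (p x : M) (w : E) : M :=
  if x ∈ (chartAt H p).source then (extChartAt I p).symm (extChartAt I p x + w) else x

lemma addInChart_zero (p x : M) : addInChart I p x 0 = x := by
  unfold addInChart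
  split_ifs with hx
  · rw [add_zero, (extChartAt I p).left_inv (by rwa [extChartAt_source])]
  · rfl

lemma extChartAt_addInChart {p x : M} {w : E} (hx : x ∈ (chartAt H p).source)
    (hw : extChartAt I p x + w ∈ (extChartAt I p).target) :
    extChartAt I p (addInChart I p x w) = extChartAt I p x + w := by
  rw [addInChart, if_pos hx, (extChartAt I p).right_inv hw]

lemma eventually_extChartAt_add_mem_interior [IsManifold I 1 M] {p x : M}
    (hx : x ∈ (chartAt H p).source) (hi : I.IsInteriorPoint x) :
    ∀ᶠ q in 𝓝 (x, (0 : E)), q.1 ∈ (chartAt H p).source ∧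
      extChartAt I p q.1 + q.2 ∈ interior (extChartAt I p).target := by
  have hcont : ContinuousAt (fun q : M × E => extChartAt I p q.1 + q.2) (x, 0) :=
    ((continuousAt_extChartAt' (by rwa [extChartAt_source])).comp continuousAt_fst).add
      continuousAt_snd
  refine (continuousAt_fst.eventually ((chartAt H p).open_source.mem_nhds hx)).and
    (hcont.eventually (isOpen_interior.mem_nhds ?_))
  simp only [add_zero]
  exact (I.isInteriorPoint_iff_of_mem_atlas one_ne_zero (chart_mem_atlas H p) hx).1 hi

lemma trivializationAt_snd_mfderiv_one [IsManifold I 1 M] {x : ℝ → M} {p : M} {s : ℝ}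
    (hx : MDifferentiableAt 𝓘(ℝ, ℝ) I x s) (hp : x s ∈ (chartAt H p).source) :
    (trivializationAt E (TangentSpace I) p
      (⟨x s, mfderiv 𝓘(ℝ, ℝ) I x s (1 : ℝ)⟩ : TangentBundle I M)).2 =
      deriv (fun r => extChartAt I p (x r)) s :=
  (trivializationAt_snd_mfderiv hx hp (1 : ℝ)).trans (mvfderiv_one_eq_deriv _ s)

variable [IsManifold I ∞ M]

lemma eventually_contMDiffAt_addInChart {p x : M} (hx : x ∈ (chartAt H p).source)
    (hi : I.IsInteriorPoint x) :
    ∀ᶠ q in 𝓝 (x, (0 : E)), ContMDiffAt (I.prod 𝓘(ℝ, E)) I ∞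
      (fun q : M × E => addInChart I p q.1 q.2) q := by
  filter_upwards [eventually_extChartAt_add_mem_interior hx hi] with q ⟨hq, hqi⟩
  have hadd : ContMDiffAt (I.prod 𝓘(ℝ, E)) 𝓘(ℝ, E) ∞
      (fun q : M × E => extChartAt I p q.1 + q.2) q :=
    ((contMDiffAt_extChartAt' hq).comp q contMDiffAt_fst).add contMDiffAt_snd
  refine (((contMDiffOn_extChartAt_symm p).contMDiffAt
    (mem_interior_iff_mem_nhds.1 hqi)).comp q hadd).congr_of_eventuallyEq ?_
  filter_upwards [continuousAt_fst.eventually ((chartAt H p).open_source.mem_nhds hq)] with r hr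
  exact if_pos hr

lemma tangentBundle_ext {p : M} {u v : TangentBundle I M} (hproj : u.proj = v.proj)
    (hu : u.proj ∈ (trivializationAt E (TangentSpace I) p).baseSet)
    (hsnd : (trivializationAt E (TangentSpace I) p u).2 =
      (trivializationAt E (TangentSpace I) p v).2) : u = v := by
  obtain ⟨x, u⟩ := u
  obtain ⟨_, v⟩ := v
  obtain rfl : x = _ := hproj
  rw [← symmL_trivializationAt_snd u hu, hsnd, symmL_trivializationAt_snd v hu]

lemma mk_mfderiv_addInChart {x : ℝ → M} {p x₀ : M} {u v : TangentSpace I x₀}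
    (hx : MDifferentiableAt 𝓘(ℝ, ℝ) I x 0)
    (hxu : (⟨x 0, mfderiv 𝓘(ℝ, ℝ) I x 0 (1 : ℝ)⟩ : TangentBundle I M) = ⟨x₀, u⟩)
    (hx₀ : x₀ ∈ (chartAt H p).source) (hi : I.IsInteriorPoint x₀) :
    letI y : ℝ → M := fun s => addInChart I p (x s)
      (s • (trivializationAt E (TangentSpace I) p).continuousLinearMapAt ℝ x₀ v)
    (⟨y 0, mfderiv 𝓘(ℝ, ℝ) I y 0 (1 : ℝ)⟩ : TangentBundle I M) = ⟨x₀, u + v⟩ := by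
  set w := (trivializationAt E (TangentSpace I) p).continuousLinearMapAt ℝ x₀ v
  set y : ℝ → M := fun s => addInChart I p (x s) (s • w)
  obtain rfl : x 0 = x₀ := congrArg TotalSpace.proj hxu
  obtain rfl : mfderiv 𝓘(ℝ, ℝ) I x 0 (1 : ℝ) = u := TotalSpace.mk_inj.1 hxu
  have hy₀ : y 0 = x 0 := by simp only [y, zero_smul, addInChart_zero]
  have hline : HasDerivAt (fun s : ℝ => s • w) w 0 := by
    simpa using (hasDerivAt_id (0 : ℝ)).smul_const w
  have hpair : Tendsto (fun s : ℝ => (x s, s • w)) (𝓝 0) (𝓝 (x 0, (0 : E))) := by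
    simpa only [ContinuousAt, zero_smul] using hx.continuousAt.prodMk hline.continuousAt
  have hy : MDifferentiableAt 𝓘(ℝ, ℝ) I y 0 := by
    have hadd := (eventually_contMDiffAt_addInChart hx₀ hi).self_of_nhds
    rw [← zero_smul ℝ w] at hadd
    exact MDifferentiableAt.comp (g := fun q : M × E => addInChart I p q.1 q.2) (0 : ℝ)
      (hadd.mdifferentiableAt (by simp)) (hx.prodMk hline.differentiableAt.mdifferentiableAt)
  have hcoord : (fun s => extChartAt I p (y s)) =ᶠ[𝓝 0] fun s => extChartAt I p (x s) + s • w := by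
    filter_upwards [hpair.eventually (eventually_extChartAt_add_mem_interior hx₀ hi)]
      with s ⟨hs, hsi⟩
    exact extChartAt_addInChart hs (interior_subset hsi)
  have hxcoord : DifferentiableAt ℝ (fun s => extChartAt I p (x s)) 0 :=
    ((mdifferentiableAt_extChartAt hx₀).comp 0 hx).differentiableAt
  refine tangentBundle_ext (p := p) hy₀ (hy₀ ▸ hx₀) ?_
  calc (trivializationAt E (TangentSpace I) p
        (⟨y 0, mfderiv 𝓘(ℝ, ℝ) I y 0 (1 : ℝ)⟩ : TangentBundle I M)).2
    _ = deriv (fun s => extChartAt I p (x s)) 0 + w := by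
      rw [trivializationAt_snd_mfderiv_one hy (hy₀ ▸ hx₀), hcoord.deriv_eq,
        (hxcoord.hasDerivAt.fun_add hline).deriv]
    _ = _ := by
      rw [trivializationAt_snd _ hx₀, map_add, ← trivializationAt_snd _ hx₀,
        trivializationAt_snd_mfderiv_one hx hx₀]

end ChartAddition

section Variation

variable {E : Type*} [NormedAddCommGroup E] [NormedSpace ℝ E]
  {H : Type*} [TopologicalSpace H] {I : ModelWithCorners ℝ E H}
  {M : Type*} [TopologicalSpace M] [ChartedSpace H M]
  {EN : Type*} [NormedAddCommGroup EN] [NormedSpace ℝ EN]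
  {HN : Type*} [TopologicalSpace HN] {J : ModelWithCorners ℝ EN HN}
  {N : Type*} [TopologicalSpace N] [ChartedSpace HN N]
  {b : N → M} {j k : ∀ y, TangentSpace I (b y)} {Γ : ℝ × N → M} {p : M}

/-- `Γ` is a variation of the map `b` with velocity field `k` at time `0`. It needs to be smooth
only for small times. -/
structure IsVariation (J : ModelWithCorners ℝ EN HN) (b : N → M) (k : ∀ y, TangentSpace I (b y))
    (Γ : ℝ × N → M) : Prop where
  smooth : ∀ y, ∀ᶠ q in 𝓝 ((0 : ℝ), y), ContMDiffAt (𝓘(ℝ, ℝ).prod J) I ∞ Γ q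
  velocity : ∀ y, (⟨Γ (0, y), mfderiv 𝓘(ℝ, ℝ) I (fun s => Γ (s, y)) 0 (1 : ℝ)⟩ :
    TangentBundle I M) = ⟨b y, k y⟩

lemma IsVariation.apply_zero (hΓ : IsVariation J b k Γ) (y : N) : Γ (0, y) = b y :=
  congrArg TotalSpace.proj (hΓ.velocity y)

lemma mk_mfderiv_congr {x y : ℝ → M} {s : ℝ} (h : x =ᶠ[𝓝 s] y) :
    (⟨x s, mfderiv 𝓘(ℝ, ℝ) I x s (1 : ℝ)⟩ : TangentBundle I M) =
      ⟨y s, mfderiv 𝓘(ℝ, ℝ) I y s (1 : ℝ)⟩ :=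
  TotalSpace.ext h.self_of_nhds (heq_of_eq (DFunLike.congr_fun h.mfderiv_eq (1 : ℝ)))

lemma isVariation_zero (hb : ContMDiff J I ∞ b) :
    IsVariation J b (fun _ => (0 : TangentSpace I _)) (fun q => b q.2) where
  smooth _ := .of_forall fun q => hb.contMDiffAt.comp q contMDiffAt_snd
  velocity y := congrArg (TotalSpace.mk (b y))
    (DFunLike.congr_fun (mfderiv_const (I := 𝓘(ℝ, ℝ)) (I' := I) (x := 0) (c := b y)) (1 : ℝ))

variable [IsManifold I ∞ M]

lemma contMDiff_trivializationAt_of_closure_subset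
    (hj : ContMDiff J I.tangent ∞ (fun y => (⟨b y, j y⟩ : TangentBundle I M)))
    (hp : ∀ y ∈ closure {y | j y ≠ 0}, b y ∈ (chartAt H p).source) :
    ContMDiff J 𝓘(ℝ, E) ∞ (fun y =>
      (trivializationAt E (TangentSpace I) p).continuousLinearMapAt ℝ (b y) (j y)) := by
  intro y
  by_cases hy : y ∈ closure {y | j y ≠ 0}
  · obtain ⟨hb, hsnd⟩ := ((trivializationAt E (TangentSpace I) p).contMDiffAt_iff (IB := I)
      (x₀ := y) (f := fun y => (⟨b y, j y⟩ : TangentBundle I M))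
      ((trivializationAt E (TangentSpace I) p).mem_source.2 (hp y hy))).1 (hj y)
    refine hsnd.congr_of_eventuallyEq ?_
    filter_upwards [hb.continuousAt.eventually ((chartAt H p).open_source.mem_nhds (hp y hy))]
      with z hz
    exact (trivializationAt_snd _ hz).symm
  · refine (contMDiffAt_const (c := (0 : E))).congr_of_eventuallyEq ?_
    filter_upwards [isClosed_closure.isOpen_compl.mem_nhds hy] with z hz
    rw [not_not.1 fun hjz => hz (subset_closure hjz), map_zero]

lemma IsVariation.exists_add (hΓ : IsVariation J b k Γ)
    (hj : ContMDiff J I.tangent ∞ (fun y => (⟨b y, j y⟩ : TangentBundle I M)))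
    (hp : ∀ y ∈ closure {y | j y ≠ 0}, b y ∈ (chartAt H p).source)
    (hi : ∀ y, I.IsInteriorPoint (b y)) :
    ∃ Γ', IsVariation J b (fun y => k y + j y) Γ' := by
  set w : N → E := fun y =>
    (trivializationAt E (TangentSpace I) p).continuousLinearMapAt ℝ (b y) (j y)
  have hw : ContMDiff J 𝓘(ℝ, E) ∞ w := contMDiff_trivializationAt_of_closure_subset hj hp
  have hw₀ {y : N} (hy : y ∉ closure {y | j y ≠ 0}) : w y = 0 := by
    simp only [w, not_not.1 fun hjy => hy (subset_closure hjy), map_zero]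
  refine ⟨fun q => addInChart I p (Γ q) (q.1 • w q.2), fun y => ?_, fun y => ?_⟩
  · by_cases hy : y ∈ closure {y | j y ≠ 0}
    · have hcont : Tendsto (fun q : ℝ × N => (Γ q, q.1 • w q.2)) (𝓝 (0, y)) (𝓝 (b y, 0)) := by
        rw [← hΓ.apply_zero y, ← zero_smul ℝ (w y)]
        exact (hΓ.smooth y).self_of_nhds.continuousAt.prodMk
          (continuousAt_fst.smul (hw.continuous.comp continuous_snd).continuousAt)
      filter_upwards [hΓ.smooth y,
        hcont.eventually (eventually_contMDiffAt_addInChart (hp y hy) (hi y))] with q hq hadd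
      exact hadd.comp q (hq.prodMk (contMDiffAt_fst.smul (hw.contMDiffAt.comp q contMDiffAt_snd)))
    · filter_upwards [hΓ.smooth y, (continuous_snd.tendsto ((0 : ℝ), y)).eventually
        (isClosed_closure.isOpen_compl.eventually_mem hy).eventually_nhds] with q hq hfar
      refine hq.congr_of_eventuallyEq ?_
      filter_upwards [(continuous_snd.tendsto q).eventually hfar] with r hr
      simp only [hw₀ hr, smul_zero, addInChart_zero]
  · by_cases hy : y ∈ closure {y | j y ≠ 0}
    · have hsmooth : ContMDiffAt 𝓘(ℝ, ℝ) I ∞ (fun s => Γ (s, y)) 0 :=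
        ContMDiffAt.comp (0 : ℝ) (hΓ.smooth y).self_of_nhds
          (contMDiffAt_id.prodMk contMDiffAt_const)
      exact mk_mfderiv_addInChart (hsmooth.mdifferentiableAt (by simp)) (hΓ.velocity y)
        (hp y hy) (hi y)
    · have hfar : (fun s => addInChart I p (Γ (s, y)) (s • w y)) =ᶠ[𝓝 0] fun s => Γ (s, y) :=
        .of_forall fun s => by simp only [hw₀ hy, smul_zero, addInChart_zero]
      rw [mk_mfderiv_congr hfar, hΓ.velocity y, not_not.1 fun hjy => hy (subset_closure hjy),
        add_zero]

lemma exists_isVariation [FiniteDimensional ℝ EN] [IsManifold J ∞ N] [T2Space N] [CompactSpace N]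
    {h : ∀ y, TangentSpace I (b y)}
    (hh : ContMDiff J I.tangent ∞ (fun y => (⟨b y, h y⟩ : TangentBundle I M)))
    (hi : ∀ y, I.IsInteriorPoint (b y)) : ∃ Γ, IsVariation J b h Γ := by
  classical
  have hb : ContMDiff J I ∞ b := fun y => (Bundle.contMDiffAt_totalSpace.1 (hh y)).1
  obtain ⟨T, hT⟩ := CompactSpace.elim_nhds_subcover (fun y => b ⁻¹' (chartAt H (b y)).source)
    fun y => hb.continuous.continuousAt.preimage_mem_nhds (chart_source_mem_nhds H (b y))
  obtain ⟨ρ, hρ⟩ := SmoothPartitionOfUnity.exists_isSubordinate J (isClosed_univ (X := N))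
    (fun i : T => b ⁻¹' (chartAt H (b i)).source)
    (fun i => (chartAt H (b i)).open_source.preimage hb.continuous)
    (hT.ge.trans (Set.iUnion_subtype (· ∈ T) fun i => b ⁻¹' (chartAt H (b i)).source).ge)
  have hsum (S : Finset T) : ∃ Γ, IsVariation J b (fun y => ∑ i ∈ S, ρ i y • h y) Γ := by
    induction S using Finset.induction_on with
    | empty => exact ⟨_, by simpa only [Finset.sum_empty] using isVariation_zero hb⟩
    | insert i S hiS ih =>
      obtain ⟨Γ, hΓ⟩ := ih
      have hsupp : closure {y | ρ i y • h y ≠ 0} ⊆ tsupport (ρ i) :=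
        closure_mono fun y hy => left_ne_zero_of_smul hy
      obtain ⟨Γ', hΓ'⟩ := hΓ.exists_add (j := fun y => ρ i y • h y) (p := b i)
        (fun y => contMDiffAt_smul_along (ρ i).contMDiff.contMDiffAt (hh y))
        (fun y hy => hρ i (hsupp hy)) hi
      exact ⟨Γ', by simpa only [Finset.sum_insert hiS, add_comm] using hΓ'⟩
  obtain ⟨Γ, hΓ⟩ := hsum Finset.univ
  refine ⟨Γ, ?_⟩
  have hone (y : N) : ∑ i, ρ i y = 1 := by
    rw [← finsum_eq_sum_of_fintype, ρ.sum_eq_one (Set.mem_univ y)]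
  simpa only [← Finset.sum_smul, hone, one_smul] using hΓ

end Variation

section PathOfImmersions

variable {E : Type*} [NormedAddCommGroup E] [NormedSpace ℝ E]
  {H : Type*} [TopologicalSpace H] {I : ModelWithCorners ℝ E H}
  {M : Type*} [TopologicalSpace M] [ChartedSpace H M]

lemma eventually_snd_ne_zero [IsManifold I 1 M] {X : Type*} [TopologicalSpace X]
    {U : X → TangentBundle I M} {x : X} (hU : ContinuousAt U x) (hx : (U x).snd ≠ 0) :
    ∀ᶠ y in 𝓝 x, (U y).snd ≠ 0 := by
  set e := trivializationAt E (TangentSpace I) (U x).proj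
  have hmem : (U x).proj ∈ e.baseSet := mem_baseSet_trivializationAt E (TangentSpace I) (U x).proj
  have hne : (e (U x)).2 ≠ 0 := fun h0 => hx <| by
    rw [← symmL_trivializationAt_snd (U x).snd hmem, h0, map_zero]
  have hcont : ContinuousAt (fun y => (e (U y)).2) x :=
    ((e.continuousAt (e.mem_source.2 hmem)).comp hU).snd
  filter_upwards [hcont.eventually_ne hne,
    hU.eventually (e.open_source.mem_nhds (e.mem_source.2 hmem))] with y hy hsource h0
  refine hy ((trivializationAt_snd (U y).snd (e.mem_source.1 hsource)).trans ?_)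
  rw [h0, map_zero]

variable [IsManifold I ∞ M]

lemma IsVariation.eventually_immersive {c : Imm I M} {h : ∀ t, TangentSpace I (c t)}
    {Γ : ℝ × unitInterval → M} (hΓ : IsVariation (𝓡∂ 1) c h Γ) :
    ∀ᶠ s in 𝓝 (0 : ℝ), ∀ t, ContMDiffAt (𝓘(ℝ, ℝ).prod (𝓡∂ 1)) I ∞ Γ (s, t) ∧
      mfderiv (𝓡∂ 1) I (fun t => Γ (s, t)) t 1 ≠ 0 := by
  have himm (t : unitInterval) : mfderiv (𝓡∂ 1) I (fun t => Γ (0, t)) t 1 ≠ 0 := by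
    rw [funext hΓ.apply_zero]
    exact c.immersive t
  simpa only [Set.mem_univ, true_implies] using
    isCompact_univ.eventually_forall_of_forall_eventually fun t _ => (hΓ.smooth t).and <|
      eventually_snd_ne_zero (contMDiffAt_snd_velocity (hΓ.smooth t).self_of_nhds).continuousAt
        (himm t)

lemma IsVariation.exists_represents {c : Imm I M} {h : TImm c} {Γ : ℝ × unitInterval → M}
    (hΓ : IsVariation (𝓡∂ 1) c h Γ) : ∃ γ : ℝ → Imm I M, Represents γ c h := by
  classical
  let γ (s : ℝ) : Imm I M :=
    if hs : ∀ t, ContMDiffAt (𝓘(ℝ, ℝ).prod (𝓡∂ 1)) I ∞ Γ (s, t) ∧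
        mfderiv (𝓡∂ 1) I (fun t => Γ (s, t)) t 1 ≠ 0 then
      ⟨fun t => Γ (s, t), fun t => (hs t).1.comp t (contMDiffAt_const.prodMk contMDiffAt_id),
        fun t => (hs t).2⟩
    else c
  have hγ : ∀ᶠ s in 𝓝 (0 : ℝ), ∀ t, ContMDiffAt (𝓘(ℝ, ℝ).prod (𝓡∂ 1)) I ∞ Γ (s, t) ∧
      γ s t = Γ (s, t) := by
    filter_upwards [hΓ.eventually_immersive] with s hs t
    exact ⟨(hs t).1, by simp only [γ, dif_pos hs]⟩
  obtain ⟨ε, hε, hball⟩ := Metric.eventually_nhds_iff_ball.1 hγ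
  rw [Real.ball_zero_eq_Ioo] at hball
  refine ⟨γ, ⟨ε, hε, fun q hq => ?_⟩, fun t => ?_⟩
  · exact (hball q.1 hq.1 q.2).1.contMDiffWithinAt.congr (fun r hr => (hball r.1 hr.1 r.2).2)
      (hball q.1 hq.1 q.2).2
  · exact (mk_mfderiv_congr (hγ.mono fun s hs => (hs t).2)).trans (hΓ.velocity t)

end PathOfImmersions

section InvSqrtNorm

variable {E : Type*} [NormedAddCommGroup E] [NormedSpace ℝ E]
  {H : Type*} [TopologicalSpace H] {I : ModelWithCorners ℝ E H}
  {M : Type*} [TopologicalSpace M] [ChartedSpace H M] [IsManifold I ∞ M]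
  [RiemannianBundle (fun x : M => TangentSpace I x)]
  [IsContMDiffRiemannianBundle I ∞ E (fun x : M => TangentSpace I x)]

section Smoothness

variable {EX : Type*} [NormedAddCommGroup EX] [NormedSpace ℝ EX]
  {HX : Type*} [TopologicalSpace HX] {K : ModelWithCorners ℝ EX HX}
  {X : Type*} [TopologicalSpace X] [ChartedSpace HX X]
  {b : X → M} {v : ∀ x, TangentSpace I (b x)} {x : X}

lemma contMDiffAt_norm_along
    (hv : ContMDiffAt K I.tangent ∞ (fun y => (⟨b y, v y⟩ : TangentBundle I M)) x)
    (hx : v x ≠ 0) : ContMDiffAt K 𝓘(ℝ, ℝ) ∞ (fun y => ‖v y‖) x := by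
  simp only [norm_eq_sqrt_real_inner]
  exact (Real.contDiffAt_sqrt (inner_self_ne_zero.2 hx)).contMDiffAt.comp x
    (ContMDiffAt.inner_bundle hv hv)

lemma contMDiffAt_inv_sqrt_norm_smul
    (hv : ContMDiffAt K I.tangent ∞ (fun y => (⟨b y, v y⟩ : TangentBundle I M)) x)
    (hx : v x ≠ 0) :
    ContMDiffAt K I.tangent ∞ (fun y => (⟨b y, (√‖v y‖)⁻¹ • v y⟩ : TangentBundle I M)) x := by
  have hnorm : ‖v x‖ ≠ 0 := norm_ne_zero_iff.2 hx
  have hroot : ContDiffAt ℝ ∞ (fun r => (√r)⁻¹) ‖v x‖ :=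
    (Real.contDiffAt_sqrt hnorm).inv (Real.sqrt_ne_zero'.2 (norm_pos_iff.2 hx))
  exact contMDiffAt_smul_along
    (ContMDiffAt.comp (g := fun r => (√r)⁻¹) x hroot.contMDiffAt (contMDiffAt_norm_along hv hx)) hv

end Smoothness

variable [FiniteDimensional ℝ E] {b : ℝ → M} {v : ∀ s, TangentSpace I (b s)} {s : ℝ}

lemma hasDerivAt_norm_of_mdifferentiableAt
    (hv : MDifferentiableAt 𝓘(ℝ, ℝ) I.tangent (fun r => (⟨b r, v r⟩ : TangentBundle I M)) s)
    (hs : v s ≠ 0) :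
    HasDerivAt (fun r => ‖v r‖)
      (inner ℝ (covDeriv 𝓘(ℝ, ℝ) b v s (1 : ℝ)) (‖v s‖⁻¹ • v s)) s := by
  simp only [norm_eq_sqrt_real_inner (v _)]
  refine ((hasDerivAt_inner_of_mdifferentiableAt hv hv).sqrt
    (inner_self_ne_zero.2 hs)).congr_deriv ?_
  rw [real_inner_comm (covDeriv 𝓘(ℝ, ℝ) b v s (1 : ℝ)) (v s), ← two_mul, real_inner_smul_right,
    mul_div_mul_left _ _ two_ne_zero]
  ring

lemma hasDerivAt_inv_sqrt_norm
    (hv : MDifferentiableAt 𝓘(ℝ, ℝ) I.tangent (fun r => (⟨b r, v r⟩ : TangentBundle I M)) s)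
    (hs : v s ≠ 0) :
    HasDerivAt (fun r => (√‖v r‖)⁻¹) (-(√‖v s‖)⁻¹ * (1 / 2 *
      inner ℝ (covDeriv 𝓘(ℝ, ℝ) b v s (1 : ℝ)) (‖v s‖⁻¹ • v s) * ‖v s‖⁻¹)) s := by
  have hpos : 0 < ‖v s‖ := norm_pos_iff.2 hs
  refine (((hasDerivAt_norm_of_mdifferentiableAt hv hs).sqrt hpos.ne').inv
    (Real.sqrt_ne_zero'.2 hpos)).congr_deriv ?_
  rw [Real.sq_sqrt hpos.le]
  field_simp

lemma covDeriv_inv_sqrt_norm_smul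
    (hv : MDifferentiableAt 𝓘(ℝ, ℝ) I.tangent (fun r => (⟨b r, v r⟩ : TangentBundle I M)) s)
    (hs : v s ≠ 0) :
    covDeriv 𝓘(ℝ, ℝ) b (fun r => (√‖v r‖)⁻¹ • v r) s (1 : ℝ) =
      (√‖v s‖)⁻¹ • (covDeriv 𝓘(ℝ, ℝ) b v s (1 : ℝ) - (1 / 2 : ℝ) •
        inner ℝ (covDeriv 𝓘(ℝ, ℝ) b v s (1 : ℝ)) (‖v s‖⁻¹ • v s) • ‖v s‖⁻¹ • v s) := by
  have hroot := hasDerivAt_inv_sqrt_norm hv hs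
  rw [covDeriv_smul hroot.differentiableAt.mdifferentiableAt hv (1 : ℝ), mvfderiv_one_eq_deriv,
    hroot.deriv]
  module

end InvSqrtNorm

section SquareRootVelocity

lemma inner_sub_half_proj {V : Type*} [NormedAddCommGroup V] [InnerProductSpace ℝ V]
    {x y v : V} (hv : inner ℝ v v = (1 : ℝ)) :
    inner ℝ (x - (1 / 2 : ℝ) • inner ℝ x v • v) (y - (1 / 2 : ℝ) • inner ℝ y v • v) =
      inner ℝ (x - inner ℝ x v • v) (y - inner ℝ y v • v) +
        1 / 4 * inner ℝ (inner ℝ x v • v) (inner ℝ y v • v) := by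
  simp only [inner_sub_left, inner_sub_right, real_inner_smul_left, real_inner_smul_right, hv,
    real_inner_comm y v]
  ring

variable {E : Type*} [NormedAddCommGroup E] [NormedSpace ℝ E]
  {H : Type*} [TopologicalSpace H] {I : ModelWithCorners ℝ E H}
  {M : Type*} [TopologicalSpace M] [ChartedSpace H M]

lemma IsSmoothPath.contMDiffAt {γ : ℝ → Imm I M} (hγ : IsSmoothPath γ) (t : unitInterval) :
    ContMDiffAt (𝓘(ℝ, ℝ).prod (𝓡∂ 1)) I ∞ (fun q : ℝ × unitInterval => γ q.1 q.2) (0, t) := by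
  obtain ⟨ε, hε, hsmooth⟩ := hγ
  refine hsmooth.contMDiffAt (prod_mem_nhds (Ioo_mem_nhds ?_ hε) univ_mem)
  exact neg_lt_zero.2 hε

variable [IsManifold I ∞ M]

lemma IsSmoothPath.mdifferentiableAt_vel {γ : ℝ → Imm I M} (hγ : IsSmoothPath γ)
    (t : unitInterval) :
    MDifferentiableAt 𝓘(ℝ, ℝ) I.tangent
      (fun s => (⟨γ s t, (γ s).vel t⟩ : TangentBundle I M)) 0 :=
  (ContMDiffAt.comp (0 : ℝ) (contMDiffAt_snd_velocity (hγ.contMDiffAt t))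
    (contMDiffAt_id.prodMk contMDiffAt_const)).mdifferentiableAt (by simp)

lemma Represents.apply_zero {γ : ℝ → Imm I M} {c : Imm I M} {h : TImm c}
    (hγ : Represents γ c h) : γ 0 = c := by
  have hfun : (γ 0).toFun = c.toFun := funext fun t => congrArg TotalSpace.proj (hγ.2 t)
  cases hγ₀ : γ 0
  cases c
  simp_all only

section ArcLength

variable [RiemannianBundle (fun x : M => TangentSpace I x)] [FiniteDimensional ℝ E]

lemma covDeriv_eq_smul_covArc {c : Imm I M} (h : TImm c) (t : unitInterval) :
    covDeriv (𝓡∂ 1) c h t 1 = ‖c.vel t‖ • covArc h t :=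
  (smul_inv_smul₀ (norm_ne_zero_iff.2 (c.immersive t)) _).symm

lemma inner_covArc_sub_half_covArcT {c : Imm I M} (h k : TImm c) (t : unitInterval) :
    inner ℝ (covArc h t - (1 / 2 : ℝ) • covArcT h t) (covArc k t - (1 / 2 : ℝ) • covArcT k t) =
      inner ℝ (covArcN h t) (covArcN k t) + 1 / 4 * inner ℝ (covArcT h t) (covArcT k t) := by
  refine inner_sub_half_proj ?_
  have hnorm : ‖‖c.vel t‖⁻¹ • c.vel t‖ = 1 := norm_smul_inv_norm (𝕜 := ℝ) (c.immersive t)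
  rw [real_inner_self_eq_norm_sq, hnorm, one_pow]

end ArcLength

variable [RiemannianBundle (fun x : M => TangentSpace I x)]
  [IsContMDiffRiemannianBundle I ∞ E (fun x : M => TangentSpace I x)]

lemma IsSmoothPath.contMDiffAt_srvf {γ : ℝ → Imm I M} (hγ : IsSmoothPath γ) (t : unitInterval) :
    ContMDiffAt (𝓘(ℝ, ℝ).prod (𝓡∂ 1)) I.tangent ∞
      (fun q : ℝ × unitInterval => (srvf (γ q.1)).curve q.2) (0, t) :=
  contMDiffAt_inv_sqrt_norm_smul (contMDiffAt_snd_velocity (hγ.contMDiffAt t))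
    ((γ 0).immersive t)

variable [FiniteDimensional ℝ E]

lemma Represents.covDeriv_vel {γ : ℝ → Imm I M} {h : TImm (γ 0)} (hγ : Represents γ (γ 0) h)
    (t : unitInterval) :
    covDeriv 𝓘(ℝ, ℝ) (fun s => γ s t) (fun s => (γ s).vel t) 0 (1 : ℝ) =
      ‖(γ 0).vel t‖ • covArc h t := by
  have hh : (fun t => mfderiv 𝓘(ℝ, ℝ) I (fun s => γ s t) 0 (1 : ℝ)) = h.toFun :=
    funext fun t => TotalSpace.mk_inj.1 (hγ.2 t)
  calc covDeriv 𝓘(ℝ, ℝ) (fun s => γ s t) (fun s => (γ s).vel t) 0 (1 : ℝ)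
    _ = covDeriv (𝓡∂ 1) (γ 0) (fun t => mfderiv 𝓘(ℝ, ℝ) I (fun s => γ s t) 0 (1 : ℝ)) t 1 :=
      covDeriv_velocity_comm (Γ := fun q => γ q.1 q.2) (q := (0, t)) (hγ.1.contMDiffAt t)
    _ = covDeriv (𝓡∂ 1) (γ 0) h t 1 := congrArg (fun k => covDeriv (𝓡∂ 1) (γ 0) k t 1) hh
    _ = ‖(γ 0).vel t‖ • covArc h t := covDeriv_eq_smul_covArc h t

lemma Represents.vp_mfderiv_srvf {γ : ℝ → Imm I M} {h : TImm (γ 0)}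
    (hγ : Represents γ (γ 0) h) (t : unitInterval) :
    vp (u := (srvf (γ 0)).curve t)
        (mfderiv 𝓘(ℝ, ℝ) I.tangent (fun s => (srvf (γ s)).curve t) 0 (1 : ℝ)) =
      √‖(γ 0).vel t‖ • (covArc h t - (1 / 2 : ℝ) • covArcT h t) := by
  have hne : (γ 0).vel t ≠ 0 := (γ 0).immersive t
  refine (covDeriv_inv_sqrt_norm_smul (hγ.1.mdifferentiableAt_vel t) hne).trans ?_
  rw [hγ.covDeriv_vel t, real_inner_smul_left]
  set a := ‖(γ 0).vel t‖
  calc (√a)⁻¹ • (a • covArc h t - (1 / 2 : ℝ) • _)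
    _ = (a / √a) • (covArc h t - (1 / 2 : ℝ) • covArcT h t) := by
      rw [covArcT]
      module
    _ = √a • (covArc h t - (1 / 2 : ℝ) • covArcT h t) := by rw [Real.div_sqrt]

lemma Represents.exists_srvf_velocity {γ : ℝ → Imm I M} {c : Imm I M} {h : TImm c}
    (hγ : Represents γ c h) (t : unitInterval) :
    ∃ ξ : TangentSpace I.tangent ((srvf c).curve t),
      (⟨(srvf (γ 0)).curve t,
        mfderiv 𝓘(ℝ, ℝ) I.tangent (fun s => (srvf (γ s)).curve t) 0 (1 : ℝ)⟩ :
        TangentBundle I.tangent (TangentBundle I M)) = ⟨(srvf c).curve t, ξ⟩ ∧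
      hp ξ = h t ∧
      vp ξ = √‖c.vel t‖ • (covArc h t - (1 / 2 : ℝ) • covArcT h t) := by
  obtain rfl := hγ.apply_zero
  have hdiff : MDifferentiableAt 𝓘(ℝ, ℝ) I.tangent (fun s => (srvf (γ s)).curve t) 0 :=
    (ContMDiffAt.comp (0 : ℝ) (hγ.1.contMDiffAt_srvf t)
      (contMDiffAt_id.prodMk contMDiffAt_const)).mdifferentiableAt (by simp)
  exact ⟨_, rfl, (hp_mfderiv hdiff (1 : ℝ)).trans (TotalSpace.mk_inj.1 (hγ.2 t)),
    hγ.vp_mfderiv_srvf t⟩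

lemma IsTangentSRVF.hp_eq_vp_eq {c : Imm I M} {h : TImm c} {ξ : TTImm (srvf c)}
    (hξ : IsTangentSRVF c h ξ) (t : unitInterval) :
    hp (ξ t) = h t ∧ vp (ξ t) = √‖c.vel t‖ • (covArc h t - (1 / 2 : ℝ) • covArcT h t) := by
  obtain ⟨⟨γ, hγ⟩, hvel⟩ := hξ
  obtain ⟨ζ, hζ, hhp, hvp⟩ := hγ.exists_srvf_velocity t
  obtain rfl : ξ t = ζ := TotalSpace.mk_inj.1 ((hvel γ hγ t).symm.trans hζ)
  exact ⟨hhp, hvp⟩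

lemma IsTangentSRVF.unique {c : Imm I M} {h : TImm c} {ξ η : TTImm (srvf c)}
    (hξ : IsTangentSRVF c h ξ) (hη : IsTangentSRVF c h η) : ξ = η := by
  have hfun : ξ.toFun = η.toFun := funext fun t => eq_of_hp_eq_of_vp_eq
    ((hξ.hp_eq_vp_eq t).1.trans (hη.hp_eq_vp_eq t).1.symm)
    ((hξ.hp_eq_vp_eq t).2.trans (hη.hp_eq_vp_eq t).2.symm)
  cases ξ
  cases η
  cases hfun
  rfl

lemma Represents.exists_isTangentSRVF {γ : ℝ → Imm I M} {c : Imm I M} {h : TImm c}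
    (hγ : Represents γ c h) : ∃ ξ : TTImm (srvf c), IsTangentSRVF c h ξ := by
  choose ζ hζ hhp hvp using hγ.exists_srvf_velocity
  have hsmooth : ContMDiff (𝓡∂ 1) I.tangent.tangent ∞ (fun t =>
      (⟨(srvf c).curve t, ζ t⟩ : TangentBundle I.tangent (TangentBundle I M))) := fun t => by
    simp only [← hζ]
    exact (contMDiffAt_fst_velocity (hγ.1.contMDiffAt_srvf t)).comp t
      (contMDiffAt_const.prodMk contMDiffAt_id)
  refine ⟨⟨ζ, hsmooth⟩, ⟨γ, hγ⟩, fun γ' hγ' t => ?_⟩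
  obtain ⟨ζ', hζ', hhp', hvp'⟩ := hγ'.exists_srvf_velocity t
  rw [hζ', eq_of_hp_eq_of_vp_eq (hhp'.trans (hhp t).symm) (hvp'.trans (hvp t).symm)]

lemma IsTangentSRVF.G_eq_GTilde {c : Imm I M} {h k : TImm c} {ξ η : TTImm (srvf c)}
    (hξ : IsTangentSRVF c h ξ) (hη : IsTangentSRVF c k η) : G c h k = GTilde (srvf c) ξ η := by
  have hvp (t : unitInterval) : (inner ℝ (covArcN h t) (covArcN k t) +
      1 / 4 * inner ℝ (covArcT h t) (covArcT k t)) * ‖c.vel t‖ = inner ℝ (vp (ξ t)) (vp (η t)) := by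
    rw [(hξ.hp_eq_vp_eq t).2, (hη.hp_eq_vp_eq t).2, ← inner_covArc_sub_half_covArcT]
    refine Eq.trans ?_ ((real_inner_smul_left _ _ _).trans
      (congrArg _ (real_inner_smul_right _ _ _))).symm
    rw [← mul_assoc, Real.mul_self_sqrt (norm_nonneg _), mul_comm]
    rfl
  rw [G, GTilde, (hξ.hp_eq_vp_eq 0).1, (hη.hp_eq_vp_eq 0).1]
  simp only [hvp]
  rfl

end SquareRootVelocity

end SRV

end

theorem proposition1_general {E : Type*} [NormedAddCommGroup E] [NormedSpace ℝ E]
    [FiniteDimensional ℝ E] {H : Type*} [TopologicalSpace H] {I : ModelWithCorners ℝ E H}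
    {M : Type*} [TopologicalSpace M] [ChartedSpace H M] [IsManifold I ∞ M]
    [RiemannianBundle (fun x : M => TangentSpace I x)]
    [IsContMDiffRiemannianBundle I ∞ E (fun x : M => TangentSpace I x)]
    (c : SRV.Imm I M) (hc : ∀ t, I.IsInteriorPoint (c t)) :
    (∀ h : SRV.TImm c, ∃! ξ : SRV.TTImm (SRV.srvf c), SRV.IsTangentSRVF c h ξ) ∧
    ∀ (h k : SRV.TImm c) (ξ η : SRV.TTImm (SRV.srvf c)),
      SRV.IsTangentSRVF c h ξ → SRV.IsTangentSRVF c k η →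
      SRV.G c h k = SRV.GTilde (SRV.srvf c) ξ η := by
  refine ⟨fun h => ?_, fun h k ξ η hξ hη => hξ.G_eq_GTilde hη⟩
  obtain ⟨Γ, hΓ⟩ := SRV.exists_isVariation h.smooth hc
  obtain ⟨γ, hγ⟩ := hΓ.exists_represents
  obtain ⟨ξ, hξ⟩ := hγ.exists_isTangentSRVF
  exact ⟨ξ, hξ, fun η hη => hη.unique hξ⟩

theorem proposition1 {E : Type*} [NormedAddCommGroup E] [NormedSpace ℝ E] [FiniteDimensional ℝ E]
    {H : Type*} [TopologicalSpace H] {I : ModelWithCorners ℝ E H} [I.Boundaryless]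
    {M : Type*} [TopologicalSpace M] [ChartedSpace H M] [IsManifold I ∞ M]
    [RiemannianBundle (fun x : M => TangentSpace I x)]
    [IsContMDiffRiemannianBundle I ∞ E (fun x : M => TangentSpace I x)]
    (c : SRV.Imm I M) :
    (∀ h : SRV.TImm c, ∃! ξ : SRV.TTImm (SRV.srvf c), SRV.IsTangentSRVF c h ξ) ∧
    ∀ (h k : SRV.TImm c) (ξ η : SRV.TTImm (SRV.srvf c)),
      SRV.IsTangentSRVF c h ξ → SRV.IsTangentSRVF c k η →
      SRV.G c h k = SRV.GTilde (SRV.srvf c) ξ η :=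
  proposition1_general c fun _ => BoundarylessManifold.isInteriorPoint
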